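/- **Setting.** Let $\mathcal X$ be a finite-dimensional real inner product space, and equip the space of linear operators $\mathcal X\to\mathcal X$ with $\langle A,B\rangle=\operatorname{tr}(AB^*)$, the operator norm $\|\cdot\|_{\rm op}$ and the trace norm $\|A\|_{\rm tr}=\operatorname{tr}\sqrt{AA^*}$. Let $\mathcal H$ be a linear subspace of the self-adjoint operators such that $I\in\mathcal H$, $HFH\in\mathcal H$ for all $H,F\in\mathcal H$, and the orthogonal projection $P_{\mathcal H}$ onto $\mathcal H$ maps positive definite operators to positive definite operators. Write $zz^*$ for the operator $x\mapsto z\langle z,x\rangle$ and $\|x\|_H=\sqrt{\langle x,Hx\rangle}$, and put $\mathcal R(x)=\big\|\sqrt{P_{\mathcal H}(xx^*)}\big\|_{\rm op}$ and $Q_R=\{x\in\mathcal X:\mathcal R(x)\le R\}$. Let $R,\delta,L>0$, $\nu\in[0,1]$, $\sigma\ge 0$, and let $B\in\mathcal H$ be positive definite with $\|B\|_{\rm tr}=1$. Let $f:\mathcal X\to\mathbb R$ be convex and $(L,\nu)$-Hölder smooth with respect to $\|\cdot\|_B$, that is, $\|u-v\|_{B^{-1}}\le L\|x-y\|_B^\nu$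 for all $x,y\in\mathcal X$, $u\in\partial f(x)$, $v\in\partial f(y)$. Let $x^*\in Q_R$ be a minimizer of $f$ over $Q_R$ and $f^*=f(x^*)$. Let $\nabla_\xi f(x)$, $\xi\sim\mathcal D$, be a (jointly measurable) stochastic estimator of a (sub)gradient $\nabla f(x)\in\partial f(x)$ with $\mathbb E_\xi[\nabla_\xi f(x)-\nabla f(x)]=0$ and $\mathbb E_\xi\|\nabla_\xi f(x)-\nabla f(x)\|_{B^{-1}}^2\le\sigma^2$ for every $x\in\mathcal X$. **Algorithm (accelerated generalized Leon).** Let $\eta=R$ and $\alpha_k=1+k/2$. Start from $x_0=\bar x_0=0$, $m_{-1}=0$, $S_0=\delta^2 I$. For $k=0,1,2,\dots$ sample $\xi_k,\xi'_{k+1}\sim\mathcal D$ (all samples independent) and set $$g_k=\nabla_{\xi_k}f_k(x_k),\quad m_k=m_{k-1}+g_k,\quad x_{k+1}=-\nabla\Psi_k^*(m_k),\quad \bar x_{k+1}=\tfrac1{\alpha_k}x_{k+1}+\big(1-\tfrac1{\alpha_k}\big)\bar x_k,$$ $$\tilde g_{k+1}=\nabla_{\xi'_{k+1}}f_k(x_{k+1}),\qquad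 S_{k+1}=S_k+P_{\mathcal H}\big((\tilde g_{k+1}-g_k)(\tilde g_{k+1}-g_k)^*\big),$$ where $\Psi_k^*(m)=\eta\,\big\|\sqrt{P_{\mathcal H}(mm^*)+S_k}\big\|_{\rm tr}$, $f_k(x)=\alpha_k^2 f\big(x/\alpha_k+(1-1/\alpha_k)\bar x_k\big)$, and correspondingly $\nabla_\xi f_k(x)=\alpha_k\nabla_\xi f\big(x/\alpha_k+(1-1/\alpha_k)\bar x_k\big)$. **Theorem.** There is an absolute constant $C>0$ such that in every such setting the following holds. (i) For all $K\ge 0$ the output satisfies $\bar x_{K+1}\in Q_R$, the random variable $f(\bar x_{K+1})-f^*$ is integrable, and $$\mathbb E[f(\bar x_{K+1})-f^*]\le C\left(\frac{LR^{1+\nu}}{(K+1)^{(3\nu+1)/2}}+\frac{\sigma R}{(K+1)^{1/2}}+\frac{\delta R\dim\mathcal X}{(K+1)^2}\right).$$ (ii) For every $\varepsilon>0$, $\mathbb E[f(\bar x_{K+1})-f^*]\le\varepsilon$ for every $K\ge0$ with $$K+1\ge C\left(\Big(\frac{LR^{1+\nu}}{\varepsilon}\Big)^{\frac2{1+3\nu}}+\Big(\frac{\sigma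 R}{\varepsilon}\Big)^2+\Big(\frac{\delta R\dim\mathcal X}{\varepsilon}\Big)^{\frac12}\right).$$ (iii) The complexity is dimension-independent for small $\delta$: if $\varepsilon>0$ and $C\,\delta R\dim\mathcal X\le\varepsilon$, then $\mathbb E[f(\bar x_{K+1})-f^*]\le\varepsilon$ for every $K\ge0$ with $K+1\ge C\big(\big(LR^{1+\nu}/\varepsilon\big)^{2/(1+3\nu)}+(\sigma R/\varepsilon)^2\big)$. -/

import Mathlib

open MeasureTheory ProbabilityTheory InnerProductSpace
open scoped RealInnerProductSpace Gradient

noncomputable section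

namespace Leon

set_option linter.unusedSectionVars false

section Operators

variable {X : Type*} [NormedAddCommGroup X] [InnerProductSpace ℝ X] [FiniteDimensional ℝ X]

/-- Trace of a linear operator on `X`. -/
def tr (A : X →L[ℝ] X) : ℝ := LinearMap.trace ℝ X (A : X →ₗ[ℝ] X)

theorem tr_eq_sum {ι : Type*} [Fintype ι] (b : OrthonormalBasis ι ℝ X) (A : X →L[ℝ] X) :
    tr A = ∑ i, ⟪b i, A (b i)⟫ := by
  simpa [tr] using LinearMap.trace_eq_sum_inner (A : X →ₗ[ℝ] X) b

/-- Positive definite self-adjoint operators. -/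
def IsPosDef (A : X →L[ℝ] X) : Prop :=
  IsSelfAdjoint A ∧ ∀ x : X, x ≠ 0 → 0 < ⟪x, A x⟫

/-- The square root of a positive semidefinite operator, through an orthonormal
eigenbasis (and `0` if `A` is not symmetric). See `opSqrt_isPositive` and `opSqrt_mul_self`. -/
def opSqrt (A : X →L[ℝ] X) : X →L[ℝ] X :=
  open Classical in
  if h : (A : X →ₗ[ℝ] X).IsSymmetric then
    ∑ i, √(h.eigenvalues rfl i) •
      rankOne ℝ (h.eigenvectorBasis rfl i) (h.eigenvectorBasis rfl i)
  else 0

theorem opSqrt_isPositive (A : X →L[ℝ] X) : (opSqrt A).IsPositive := by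
  classical
  unfold opSqrt
  split_ifs with h
  · refine ContinuousLinearMap.isPositive_sum _ fun i _ => ?_
    exact (isPositive_rankOne_self _).smul_of_nonneg (Real.sqrt_nonneg _)
  · exact ContinuousLinearMap.isPositive_zero

theorem opSqrt_mul_self {A : X →L[ℝ] X} (hA : A.IsPositive) : opSqrt A * opSqrt A = A := by
  classical
  have h : (A : X →ₗ[ℝ] X).IsSymmetric := hA.isSymmetric
  have key : ∀ j, opSqrt A (h.eigenvectorBasis rfl j)
      = √(h.eigenvalues rfl j) • h.eigenvectorBasis rfl j := by
    intro j
    unfold opSqrt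
    rw [dif_pos h]
    simp only [_root_.sum_apply, _root_.smul_apply, rankOne_apply]
    rw [Finset.sum_eq_single j]
    · simp
    · intro i _ hij
      simp [(h.eigenvectorBasis rfl).inner_eq_ite, hij]
    · simp
  apply ContinuousLinearMap.coe_injective
  refine (h.eigenvectorBasis rfl).toBasis.ext fun j => ?_
  have h2 : 0 ≤ h.eigenvalues rfl j :=
    LinearMap.IsPositive.nonneg_eigenvalues
      ((ContinuousLinearMap.isPositive_toLinearMap_iff A).2 hA) rfl j
  simp [key, smul_smul, Real.mul_self_sqrt h2]

/-- The trace norm `tr √(A A*)`. The operator norm is the norm of `X →L[ℝ] X`. -/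
def trNorm (A : X →L[ℝ] X) : ℝ := tr (opSqrt (A * ContinuousLinearMap.adjoint A))

/-- The inner product `⟨A, B⟩ = tr (A B*)` on the space of operators. -/
def frobForm : LinearMap.BilinForm ℝ (X →L[ℝ] X) :=
  LinearMap.mk₂ ℝ (fun A B => tr (A * ContinuousLinearMap.adjoint B))
    (fun A A' B => by simp [tr, add_mul]) (fun c A B => by simp [tr])
    (fun A B B' => by simp [tr, mul_add]) (fun c A B => by simp [tr])

theorem frobForm_apply (A B : X →L[ℝ] X) :
    frobForm A B = tr (A * ContinuousLinearMap.adjoint B) := rfl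

theorem frobForm_eq_sum {ι : Type*} [Fintype ι] (b : OrthonormalBasis ι ℝ X)
    (A B : X →L[ℝ] X) : frobForm A B =
      ∑ i, ⟪ContinuousLinearMap.adjoint A (b i), ContinuousLinearMap.adjoint B (b i)⟫ := by
  rw [frobForm_apply, tr_eq_sum b]
  simp [ContinuousLinearMap.adjoint_inner_left]

theorem frobForm_isSymm : (frobForm (X := X)).IsSymm := by
  refine ⟨fun A B => ?_⟩
  simp only [frobForm_eq_sum (stdOrthonormalBasis ℝ X)]
  exact Finset.sum_congr rfl fun i _ => by simp [real_inner_comm]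

theorem frobForm_self_eq_zero {A : X →L[ℝ] X} (h : frobForm A A = 0) : A = 0 := by
  rw [frobForm_eq_sum (stdOrthonormalBasis ℝ X),
    Finset.sum_eq_zero_iff_of_nonneg (fun i _ => real_inner_self_nonneg)] at h
  have h0 : ContinuousLinearMap.adjoint A = 0 := by
    apply ContinuousLinearMap.coe_injective
    refine (stdOrthonormalBasis ℝ X).toBasis.ext fun i => ?_
    simpa using h i (Finset.mem_univ i)
  simpa using congrArg ContinuousLinearMap.adjoint h0

theorem isCompl_orthogonal (ℋ : Submodule ℝ (X →L[ℝ] X)) :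
    IsCompl ℋ (frobForm.orthogonal ℋ) := by
  rw [LinearMap.BilinForm.isCompl_orthogonal_iff_disjoint frobForm_isSymm.isRefl,
    Submodule.disjoint_def]
  intro A hA hA'
  exact frobForm_self_eq_zero (hA' A hA)

/-- The orthogonal projection onto `ℋ` with respect to `⟨A, B⟩ = tr (A B*)`. -/
def proj (ℋ : Submodule ℝ (X →L[ℝ] X)) : (X →L[ℝ] X) →ₗ[ℝ] (X →L[ℝ] X) :=
  ℋ.projection (frobForm.orthogonal ℋ) (isCompl_orthogonal ℋ)

theorem proj_mem (ℋ : Submodule ℝ (X →L[ℝ] X)) (A : X →L[ℝ] X) : proj ℋ A ∈ ℋ :=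
  Submodule.projection_apply_mem _ _

theorem frobForm_sub_proj {ℋ : Submodule ℝ (X →L[ℝ] X)} (A : X →L[ℝ] X)
    {H : X →L[ℝ] X} (hH : H ∈ ℋ) : frobForm H (A - proj ℋ A) = 0 := by
  have h : A - proj ℋ A ∈ frobForm.orthogonal ℋ := by
    rw [← Submodule.projection_apply_eq_zero_iff (isCompl_orthogonal ℋ), map_sub, sub_eq_zero]
    exact (Submodule.projection_apply_of_mem_left (isCompl_orthogonal ℋ) (proj_mem ℋ A)).symm
  exact h H hH

/-- Admissible spaces `ℋ` of preconditioners. -/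
structure IsPrecondSpace (ℋ : Submodule ℝ (X →L[ℝ] X)) : Prop where
  isSelfAdjoint : ∀ H ∈ ℋ, IsSelfAdjoint H
  one_mem : (1 : X →L[ℝ] X) ∈ ℋ
  mul_mul_mem : ∀ H ∈ ℋ, ∀ F ∈ ℋ, H * F * H ∈ ℋ
  proj_posDef : ∀ A : X →L[ℝ] X, IsPosDef A → IsPosDef (proj ℋ A)

/-- The rank-one operator `z⟨z, ·⟩`. -/
def outer (z : X) : X →L[ℝ] X := rankOne ℝ z z

/-- The primal norm `‖√(proj_ℋ (z⟨z, ·⟩))‖_op`. -/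
def primalNorm (ℋ : Submodule ℝ (X →L[ℝ] X)) (x : X) : ℝ := ‖opSqrt (proj ℋ (outer x))‖

/-- The decision set: the ball of radius `R` in the primal norm. -/
def Q (ℋ : Submodule ℝ (X →L[ℝ] X)) (R : ℝ) : Set X := {x | primalNorm ℋ x ≤ R}

/-- The weighted Euclidean norm `√⟨x, H x⟩`. -/
def wnorm (H : X →L[ℝ] X) (x : X) : ℝ := √⟪x, H x⟫

/-- The dual regularizer `Ψ*(m) = η ‖√(proj_ℋ (m⟨m, ·⟩) + S)‖_tr`. -/
def Psi (η : ℝ) (ℋ : Submodule ℝ (X →L[ℝ] X)) (S : X →L[ℝ] X) (m : X) : ℝ :=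
  η * trNorm (opSqrt (proj ℋ (outer m) + S))

end Operators

section Problem

variable {X : Type*} [NormedAddCommGroup X] [InnerProductSpace ℝ X]

/-- `u ∈ ∂f(x)`. -/
def IsSubgradient (f : X → ℝ) (x u : X) : Prop := ∀ y, f x + ⟪u, y - x⟫ ≤ f y

/-- `(L, ν)`-Hölder smoothness of a convex function with respect to `‖·‖_B`: its (sub)gradients
are `ν`-Hölder with constant `L`, measured in the dual norm `‖·‖_{B⁻¹}`. -/
def IsHolderSmooth (f : X → ℝ) (B : X →L[ℝ] X) (L ν : ℝ) : Prop :=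
  ∀ x y u v, IsSubgradient f x u → IsSubgradient f y v →
    wnorm (Ring.inverse B) (u - v) ≤ L * wnorm B (x - y) ^ ν

variable [MeasurableSpace X] {Ξ : Type*} [MeasurableSpace Ξ]

/-- `G ξ x` is a stochastic estimator of the (sub)gradient `∇f(x) = gradf x ∈ ∂f(x)` whose noise
`G ξ x - gradf x` has, for `ξ ∼ D`, zero mean and variance at most `σ²` in the norm `‖·‖_{B⁻¹}`. -/
structure IsStochGrad (f : X → ℝ) (B : X →L[ℝ] X) (σ : ℝ) (D : Measure Ξ)
    (gradf : X → X) (G : Ξ → X → X) : Prop where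
  measurable : Measurable (Function.uncurry G)
  isSubgradient : ∀ x, IsSubgradient f x (gradf x)
  integrable : ∀ x, Integrable (fun ξ => G ξ x - gradf x) D
  mean_zero : ∀ x, ∫ ξ, (G ξ x - gradf x) ∂D = 0
  integrable_sq : ∀ x, Integrable (fun ξ => wnorm (Ring.inverse B) (G ξ x - gradf x) ^ 2) D
  variance_le : ∀ x, ∫ ξ, wnorm (Ring.inverse B) (G ξ x - gradf x) ^ 2 ∂D ≤ σ ^ 2

end Problem

section Algorithm

variable {X : Type*} [NormedAddCommGroup X] [InnerProductSpace ℝ X] [FiniteDimensional ℝ X]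
variable {Ξ : Type*}

/-- The variables of the algorithm at the start of iteration `k`:
`x_k`, the averaged point `x̄_k`, the sum `m_{k-1}` of the past gradients, and `S_k`. -/
structure State (X : Type*) [NormedAddCommGroup X] [InnerProductSpace ℝ X] where
  x : X
  xbar : X
  m : X
  S : X →L[ℝ] X

/-- The point `z/a + (1 - 1/a) x̄`, so that `f_k(z) = α_k² f (interp α_k x̄_k z)`. -/
def interp (a : ℝ) (xbar z : X) : X := a⁻¹ • z + (1 - a⁻¹) • xbar

/-- The stochastic gradient at `z` of `f_k(z) = a² f (z/a + (1 - 1/a) x̄)` for the sample `ξ`,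
that is, `a` times the stochastic gradient of `f` at `z/a + (1 - 1/a) x̄`, by the chain rule. -/
def auxGrad (G : Ξ → X → X) (a : ℝ) (xbar : X) (ξ : Ξ) (z : X) : X :=
  a • G ξ (interp a xbar z)

/-- One iteration with `α_k = a` and the two samples `ξ = ξ_k`, `ξ' = ξ'_{k+1}`. -/
def step (ℋ : Submodule ℝ (X →L[ℝ] X)) (η : ℝ) (G : Ξ → X → X) (a : ℝ) (ξ ξ' : Ξ)
    (s : State X) : State X :=
  let g := auxGrad G a s.xbar ξ s.x
  let m := s.m + g
  let x := -∇ (Psi η ℋ s.S) m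
  let g' := auxGrad G a s.xbar ξ' x
  { x := x
    xbar := interp a s.xbar x
    m := m
    S := s.S + proj ℋ (outer (g' - g)) }

/-- The accelerated generalized Leon algorithm along the sample sequences `ξ k = ξ_k` and
`ξ' k = ξ'_{k+1}`: `iter … k` is its state at the start of iteration `k`. -/
def iter (ℋ : Submodule ℝ (X →L[ℝ] X)) (η δ : ℝ) (α : ℕ → ℝ) (G : Ξ → X → X)
    (ξ ξ' : ℕ → Ξ) : ℕ → State X
  | 0 => { x := 0, xbar := 0, m := 0, S := δ ^ 2 • 1 }
  | k + 1 => step ℋ η G (α k) (ξ k) (ξ' k) (iter ℋ η δ α G ξ ξ' k)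

end Algorithm

end Leon

end

/-!
The algorithm is follow-the-regularized-leader on the auxiliary functions `f_k`, with the dual
regularizer `Ψ_k*(m) = R tr √(proj_ℋ (m⟨m, ·⟩) + S_k)`. The proof separates into a deterministic
regret bound, an acceleration argument along each path, and an integration.

*Regret.* `ℋ` is closed under squares, hence under polynomial functional calculus, so
`H = prec ℋ S m = √(proj_ℋ (m⟨m, ·⟩) + S)` and `H⁻¹` lie in `ℋ`, and
`tr (F proj_ℋ (m⟨m, ·⟩)) = ⟪m, F m⟫` for `F ∈ ℋ`. Consequently `∇Ψ*(m) = R H⁻¹ m`, the iterates stay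
in `Q`, and `Ψ*` dominates the support function of `Q`. Convexity of `Ψ_k*`, used between `m_k` and
the virtual point `m_{k-1} - d_{k+1}` with `d_{k+1} = g̃_{k+1} - g_k`, bounds
`⟪g_k, x_{k+1}⟫ + ⟪d_{k+1}, x_{k+1} - x_k⟫` by a difference of potentials plus a Bregman divergence
(`regret_step`). The heart of the matter is that this divergence is at most
`3 R (tr √S_{k+1} - tr √S_{k-1})`, with no boundedness of the gradients and no logarithm
(`tr_prec_step`); it follows from `2 tr √Y ≤ tr (Z⁻¹ Y) + tr Z` for a well-chosen `Z`. The sum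
telescopes to `6 R tr √S_{K+1}` (`sum_regret_le`), and the same variational inequality bounds
`tr √S_{K+1}` by `δ dim X + c/2 + (2c)⁻¹ ∑ ‖d_k‖²_{B⁻¹}` for every `c > 0`.

*Acceleration.* A Hölder smooth function is smooth with constant `2M = 2 L ρ^(ν-1)` up to an error
`M ρ²`, for every `ρ > 0`. Inexact co-coercivity (`IsHolderSmooth.cocoercive`) then yields, in each
iteration, a negative term in `‖∇f(x̄_{k+1}) - ∇f(y_k)‖²_{B⁻¹}`, where `y_k` is the first query
point. This term absorbs the deterministic part of `‖d_{k+1}‖²_{B⁻¹}` as soon as `c ≥ 36 R M`, and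
`α_{k+1}² - α_{k+1} ≤ α_k²` makes the optimality gaps telescope (`pathwise_bound`).

*Integration.* The iterates are measurable functions of finitely many samples, independent of the
fresh one, so the remaining noise terms are centred or have second moment at most `σ²`
(`IsStochGrad.noise`). Choosing `ρ = R n^(-3/2)` and `c = 36 R M + σ n^(3/2)` with `n = K + 1` gives
the rate for all `ν ∈ [0, 1]` at once (`rate_of_expectation_bound`).
-/

namespace Leon

set_option linter.unusedSectionVars false

section Operators

variable {X : Type*} [NormedAddCommGroup X] [InnerProductSpace ℝ X] [FiniteDimensional ℝ X]

/-! ### Traces and positive operators -/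

theorem inner_apply_left {A : X →L[ℝ] X} (hA : IsSelfAdjoint A) (x y : X) :
    ⟪A x, y⟫ = ⟪x, A y⟫ :=
  (ContinuousLinearMap.isSelfAdjoint_iff_isSymmetric.1 hA) x y

theorem isPositive_iff_inner {A : X →L[ℝ] X} :
    A.IsPositive ↔ IsSelfAdjoint A ∧ ∀ x, 0 ≤ ⟪x, A x⟫ := by
  refine ⟨fun h => ⟨h.isSelfAdjoint, fun x => h.inner_nonneg_right x⟩, fun h => ?_⟩
  rw [ContinuousLinearMap.isPositive_iff']
  refine ⟨h.1, fun x => ?_⟩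
  rw [inner_apply_left h.1]
  exact h.2 x

theorem tr_add (A B : X →L[ℝ] X) : tr (A + B) = tr A + tr B := by simp [tr]

theorem tr_sub (A B : X →L[ℝ] X) : tr (A - B) = tr A - tr B := by simp [tr]

theorem tr_smul (c : ℝ) (A : X →L[ℝ] X) : tr (c • A) = c * tr A := by simp [tr]

theorem tr_mul_comm (A B : X →L[ℝ] X) : tr (A * B) = tr (B * A) :=
  LinearMap.trace_mul_comm ℝ (A : X →ₗ[ℝ] X) (B : X →ₗ[ℝ] X)

theorem tr_one : tr (1 : X →L[ℝ] X) = Module.finrank ℝ X :=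
  LinearMap.trace_one (R := ℝ) (M := X)

theorem tr_nonneg {A : X →L[ℝ] X} (hA : A.IsPositive) : 0 ≤ tr A := by
  rw [tr_eq_sum (stdOrthonormalBasis ℝ X)]
  exact Finset.sum_nonneg fun i _ => hA.inner_nonneg_right _

theorem isPositive_conj {A C : X →L[ℝ] X} (hA : A.IsPositive) (hC : IsSelfAdjoint C) :
    (C * A * C).IsPositive := by
  have := hA.conj_adjoint C
  rwa [hC.adjoint_eq] at this

theorem isSelfAdjoint_mul_mul {A C : X →L[ℝ] X} (hA : IsSelfAdjoint A) (hC : IsSelfAdjoint C) :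
    IsSelfAdjoint (C * A * C) := by
  simpa [hC.star_eq] using hA.conjugate C

theorem isSelfAdjoint_outer (z : X) : IsSelfAdjoint (outer z) :=
  (isPositive_rankOne_self (𝕜 := ℝ) z).isSelfAdjoint

theorem isPositive_outer (z : X) : (outer z).IsPositive :=
  isPositive_rankOne_self (𝕜 := ℝ) z

theorem outer_apply (z x : X) : outer z x = ⟪z, x⟫ • z := rfl

theorem tr_mul_outer (F : X →L[ℝ] X) (z : X) : tr (F * outer z) = ⟪z, F z⟫ := by
  have hb := (stdOrthonormalBasis ℝ X).sum_inner_mul_inner z (F z)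
  rw [tr_eq_sum (stdOrthonormalBasis ℝ X), ← hb]
  refine Finset.sum_congr rfl fun i _ => ?_
  simp [outer_apply, inner_smul_right]

theorem outer_apply_eq_conj {A : X →L[ℝ] X} (hA : IsSelfAdjoint A) (z : X) :
    outer (A z) = A * outer z * A := by
  ext x
  simp [outer_apply, inner_apply_left hA]

theorem outer_smul (c : ℝ) (z : X) : outer (c • z) = c ^ 2 • outer z := by
  ext x
  simp only [outer_apply, inner_smul_left, smul_smul, _root_.smul_apply, conj_trivial]
  ring_nf

/-! ### Positive definite operators and their inverses -/

theorem IsPosDef.isPositive {A : X →L[ℝ] X} (hA : IsPosDef A) : A.IsPositive := by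
  refine isPositive_iff_inner.2 ⟨hA.1, fun x => ?_⟩
  rcases eq_or_ne x 0 with rfl | hx
  · simp
  · exact (hA.2 x hx).le

theorem IsPosDef.isUnit {A : X →L[ℝ] X} (hA : IsPosDef A) : IsUnit A := by
  have hinj : Function.Injective (A : X →ₗ[ℝ] X) := by
    rw [← LinearMap.ker_eq_bot, LinearMap.ker_eq_bot']
    intro x hx
    by_contra h
    have := hA.2 x h
    have hx' : A x = 0 := hx
    simp [hx'] at this
  let e := (LinearEquiv.ofInjectiveEndo (A : X →ₗ[ℝ] X) hinj).toContinuousLinearEquiv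
  refine ⟨⟨A, (e.symm : X →L[ℝ] X), ?_, ?_⟩, rfl⟩
  · ext x; exact e.apply_symm_apply x
  · ext x; exact e.symm_apply_apply x

theorem IsPosDef.mul_inverse {A : X →L[ℝ] X} (hA : IsPosDef A) : A * Ring.inverse A = 1 :=
  Ring.mul_inverse_cancel A hA.isUnit

theorem IsPosDef.inverse_mul {A : X →L[ℝ] X} (hA : IsPosDef A) : Ring.inverse A * A = 1 :=
  Ring.inverse_mul_cancel A hA.isUnit

theorem IsPosDef.apply_inverse {A : X →L[ℝ] X} (hA : IsPosDef A) (x : X) :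
    A (Ring.inverse A x) = x := by
  simpa using congrArg (fun T : X →L[ℝ] X => T x) hA.mul_inverse

theorem IsPosDef.inverse_apply {A : X →L[ℝ] X} (hA : IsPosDef A) (x : X) :
    Ring.inverse A (A x) = x := by
  simpa using congrArg (fun T : X →L[ℝ] X => T x) hA.inverse_mul

theorem IsPosDef.inverse {A : X →L[ℝ] X} (hA : IsPosDef A) : IsPosDef (Ring.inverse A) := by
  have hs : IsSelfAdjoint (Ring.inverse A) := by
    rw [ContinuousLinearMap.isSelfAdjoint_iff_isSymmetric]
    intro x y
    have := inner_apply_left hA.1 (Ring.inverse A x) (Ring.inverse A y)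
    rw [hA.apply_inverse, hA.apply_inverse] at this
    exact this.symm
  refine ⟨hs, fun x hx => ?_⟩
  have hne : Ring.inverse A x ≠ 0 := by
    intro h
    apply hx
    rw [← hA.apply_inverse x, h, map_zero]
  have := hA.2 _ hne
  rwa [hA.apply_inverse, real_inner_comm] at this

theorem IsPosDef.add {A B : X →L[ℝ] X} (hA : IsPosDef A) (hB : B.IsPositive) :
    IsPosDef (A + B) := by
  refine ⟨hA.1.add hB.isSelfAdjoint, fun x hx => ?_⟩
  have h1 := hA.2 x hx
  have h2 := hB.inner_nonneg_right x
  simp only [_root_.add_apply, inner_add_right]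
  linarith

theorem IsPosDef.smul {A : X →L[ℝ] X} (hA : IsPosDef A) {c : ℝ} (hc : 0 < c) :
    IsPosDef (c • A) := by
  refine ⟨(hA.isPositive.smul_of_nonneg hc.le).isSelfAdjoint, fun x hx => ?_⟩
  simp only [_root_.smul_apply, inner_smul_right]
  exact mul_pos hc (hA.2 x hx)

theorem isPosDef_one : IsPosDef (1 : X →L[ℝ] X) := by
  refine ⟨IsSelfAdjoint.one _, fun x hx => ?_⟩
  exact real_inner_self_pos.2 hx

/-- Weighted Young inequality for a positive operator. -/
theorem two_inner_le {A : X →L[ℝ] X} (hA : A.IsPositive) (x y : X) :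
    2 * ⟪x, A y⟫ ≤ ⟪x, A x⟫ + ⟪y, A y⟫ := by
  have h := hA.inner_nonneg_right (x - y)
  have hxy : ⟪y, A x⟫ = ⟪x, A y⟫ := by
    rw [← inner_apply_left hA.isSelfAdjoint, real_inner_comm]
  simp only [map_sub, inner_sub_left, inner_sub_right, hxy] at h
  linarith

/-- Fenchel–Young inequality for the quadratic forms of `A` and `A⁻¹`. -/
theorem two_inner_le_add_inverse {A : X →L[ℝ] X} (hA : IsPosDef A) (x y : X) :
    2 * ⟪x, y⟫ ≤ ⟪x, A x⟫ + ⟪y, Ring.inverse A y⟫ := by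
  have h := two_inner_le hA.isPositive x (Ring.inverse A y)
  rw [hA.apply_inverse] at h
  rwa [real_inner_comm y (Ring.inverse A y)] at h

/-- If `0 ≤ D ≤ Z` then `D Z⁻¹ D ≤ D`. With `y = D⁻¹ d` this is the antitonicity of the
inverse. -/
theorem inner_inverse_apply_le {D Z : X →L[ℝ] X} (hD : D.IsPositive) (hZ : IsPosDef Z)
    (hDZ : (Z - D).IsPositive) (y : X) : ⟪D y, Ring.inverse Z (D y)⟫ ≤ ⟪y, D y⟫ := by
  set w := Ring.inverse Z (D y) with hw
  have h1 := two_inner_le hD w y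
  have h2 := hDZ.inner_nonneg_right w
  have h3 : Z w = D y := hZ.apply_inverse _
  simp only [_root_.sub_apply, inner_sub_right, h3] at h2
  rw [real_inner_comm w]
  linarith

theorem inner_inverse_le {D Z : X →L[ℝ] X} (hD : IsPosDef D) (hZ : IsPosDef Z)
    (hDZ : (Z - D).IsPositive) (d : X) : ⟪d, Ring.inverse Z d⟫ ≤ ⟪d, Ring.inverse D d⟫ := by
  have h := inner_inverse_apply_le hD.isPositive hZ hDZ (Ring.inverse D d)
  rwa [hD.apply_inverse, real_inner_comm d] at h

/-! ### The square root -/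

theorem opSqrt_isSelfAdjoint (A : X →L[ℝ] X) : IsSelfAdjoint (opSqrt A) :=
  (opSqrt_isPositive A).isSelfAdjoint

theorem norm_opSqrt_apply_sq {A : X →L[ℝ] X} (hA : A.IsPositive) (x : X) :
    ‖opSqrt A x‖ ^ 2 = ⟪x, A x⟫ := by
  rw [← real_inner_self_eq_norm_sq, inner_apply_left (opSqrt_isSelfAdjoint A)]
  conv_rhs => rw [← opSqrt_mul_self hA]
  rfl

theorem apply_eq_zero_of_inner_eq_zero {A : X →L[ℝ] X} (hA : A.IsPositive) {x : X}
    (h : ⟪x, A x⟫ = 0) : A x = 0 := by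
  rw [← norm_opSqrt_apply_sq hA] at h
  have h0 : opSqrt A x = 0 := by simpa using h
  rw [← opSqrt_mul_self hA]
  simp [h0]

theorem IsPosDef.opSqrt {A : X →L[ℝ] X} (hA : IsPosDef A) : IsPosDef (opSqrt A) := by
  refine ⟨opSqrt_isSelfAdjoint A, fun x hx => ?_⟩
  refine lt_of_le_of_ne ((opSqrt_isPositive A).inner_nonneg_right x) fun h => ?_
  have h0 := apply_eq_zero_of_inner_eq_zero (opSqrt_isPositive A) h.symm
  have h1 := hA.2 x hx
  rw [← opSqrt_mul_self hA.isPositive] at h1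
  simp [h0] at h1

theorem isPositive_of_eigenvalues {T : X →L[ℝ] X} (hT : IsSelfAdjoint T)
    (h : ∀ (v : X) (c : ℝ), v ≠ 0 → T v = c • v → 0 ≤ c) : T.IsPositive := by
  have hs : (T : X →ₗ[ℝ] X).IsSymmetric :=
    ContinuousLinearMap.isSelfAdjoint_iff_isSymmetric.1 hT
  refine isPositive_iff_inner.2 ⟨hT, fun x => ?_⟩
  set b := hs.eigenvectorBasis rfl
  have hb : ∀ i, T (b i) = hs.eigenvalues rfl i • b i := fun i => hs.apply_eigenvectorBasis rfl i
  rw [← b.sum_inner_mul_inner x (T x)]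
  refine Finset.sum_nonneg fun i _ => ?_
  rw [← inner_apply_left hT, hb i, inner_smul_left, real_inner_comm]
  have h0 := h (b i) _ (b.orthonormal.ne_zero i) (hb i)
  simp only [conj_trivial]
  nlinarith [mul_nonneg h0 (mul_self_nonneg ⟪b i, x⟫)]

/-- The square root is operator monotone: an eigenvector `v` of `B - A` for a negative eigenvalue
`c` would satisfy `⟪v, (B² - A²) v⟫ = c ⟪v, (A + B) v⟫ < 0`. -/
theorem isPositive_sub_of_sq {A B : X →L[ℝ] X} (hA : A.IsPositive) (hB : IsPosDef B)
    (h : (B * B - A * A).IsPositive) : (B - A).IsPositive := by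
  refine isPositive_of_eigenvalues (hB.1.sub hA.isSelfAdjoint) fun v c hv hc => ?_
  by_contra hneg
  push Not at hneg
  have h1 := h.inner_nonneg_right v
  have h2 := hB.2 v hv
  have h3 := hA.inner_nonneg_right v
  have e1 : B v = A v + c • v := by rw [← hc]; simp
  have e2 : ⟪v, (B * B - A * A) v⟫ = c * (⟪v, B v⟫ + ⟪v, A v⟫) := by
    have : ⟪v, (B * B - A * A) v⟫ = ⟪B v, B v⟫ - ⟪A v, A v⟫ := by
      rw [inner_apply_left hB.1, inner_apply_left hA.isSelfAdjoint, ← inner_sub_right]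
      rfl
    rw [this, e1]
    simp only [inner_add_left, inner_add_right, inner_smul_left, inner_smul_right, conj_trivial,
      real_inner_comm v (A v)]
    ring
  rw [e2] at h1
  nlinarith

theorem opSqrt_sub_isPositive {A B : X →L[ℝ] X} (hA : A.IsPositive) (hB : IsPosDef B)
    (h : (B - A).IsPositive) : (opSqrt B - opSqrt A).IsPositive := by
  refine isPositive_sub_of_sq (opSqrt_isPositive A) hB.opSqrt ?_
  rwa [opSqrt_mul_self hA, opSqrt_mul_self hB.isPositive]

theorem opSqrt_sq {A : X →L[ℝ] X} (hA : IsPosDef A) : opSqrt (A * A) = A := by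
  have hp : IsPosDef (A * A) := by
    refine ⟨by simpa using isSelfAdjoint_mul_mul (IsSelfAdjoint.one _) hA.1, fun x hx => ?_⟩
    have h0 : A x ≠ 0 := fun h0 => by have := hA.2 x hx; simp [h0] at this
    have : ⟪x, (A * A) x⟫ = ⟪A x, A x⟫ := (inner_apply_left hA.1 x (A x)).symm
    rw [this]
    exact real_inner_self_pos.2 h0
  have h0 : opSqrt (A * A) * opSqrt (A * A) = A * A := opSqrt_mul_self hp.isPositive
  have h1 := isPositive_sub_of_sq hA.isPositive hp.opSqrt (by
    rw [h0, sub_self]; exact ContinuousLinearMap.isPositive_zero)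
  have h2 := isPositive_sub_of_sq (opSqrt_isPositive (A * A)) hA (by
    rw [h0, sub_self]; exact ContinuousLinearMap.isPositive_zero)
  exact le_antisymm ((ContinuousLinearMap.le_def _ _).2 h2)
    ((ContinuousLinearMap.le_def _ _).2 h1)

theorem trNorm_opSqrt {A : X →L[ℝ] X} (hA : A.IsPositive) : trNorm (opSqrt A) = tr (opSqrt A) := by
  rw [trNorm, (opSqrt_isSelfAdjoint A).adjoint_eq, opSqrt_mul_self hA]

theorem trNorm_of_isPosDef {A : X →L[ℝ] X} (hA : IsPosDef A) : trNorm A = tr A := by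
  rw [trNorm, hA.1.adjoint_eq, opSqrt_sq hA]

/-- Half of the variational formula `tr √Y = inf_Z (tr (Z⁻¹ Y) + tr Z) / 2`. -/
theorem two_tr_opSqrt_le {Y Z : X →L[ℝ] X} (hY : Y.IsPositive) (hZ : IsPosDef Z) :
    2 * tr (opSqrt Y) ≤ tr (Ring.inverse Z * Y) + tr Z := by
  set y := opSqrt Y
  have h := tr_nonneg (isPositive_conj hZ.inverse.isPositive
    ((opSqrt_isSelfAdjoint Y).sub hZ.1))
  have e : (y - Z) * Ring.inverse Z * (y - Z)
      = y * (Ring.inverse Z * y) - y * (Ring.inverse Z * Z) - Z * Ring.inverse Z * y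
        + Z * Ring.inverse Z * Z := by noncomm_ring
  rw [e, hZ.inverse_mul, hZ.mul_inverse, tr_add, tr_sub, tr_sub, tr_mul_comm y, mul_assoc,
    opSqrt_mul_self hY] at h
  simp only [mul_one, one_mul] at h
  linarith

theorem norm_opSqrt_le_iff {A : X →L[ℝ] X} (hA : A.IsPositive) {R : ℝ} (hR : 0 ≤ R) :
    ‖opSqrt A‖ ≤ R ↔ ∀ x, ⟪x, A x⟫ ≤ R ^ 2 * ‖x‖ ^ 2 := by
  constructor
  · intro h x
    rw [← norm_opSqrt_apply_sq hA, ← mul_pow]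
    exact pow_le_pow_left₀ (norm_nonneg _) (ContinuousLinearMap.le_of_opNorm_le _ h x) 2
  · intro h
    refine ContinuousLinearMap.opNorm_le_bound _ hR fun x => ?_
    have := h x
    rw [← norm_opSqrt_apply_sq hA, ← mul_pow] at this
    exact le_of_sq_le_sq this (by positivity)

theorem norm_le_of_isPositive {A : X →L[ℝ] X} (hA : A.IsPositive) {c : ℝ} (hc : 0 ≤ c)
    (h : (c • 1 - A).IsPositive) : ‖A‖ ≤ c := by
  have h1 : ‖opSqrt A‖ ≤ √c := by
    refine (norm_opSqrt_le_iff hA (Real.sqrt_nonneg c)).2 fun x => ?_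
    have := h.inner_nonneg_right x
    simp only [_root_.sub_apply, _root_.smul_apply, one_apply_eq_self, inner_sub_right,
      inner_smul_right, real_inner_self_eq_norm_sq] at this
    rw [Real.sq_sqrt hc]
    linarith
  calc ‖A‖ = ‖opSqrt A * opSqrt A‖ := by rw [opSqrt_mul_self hA]
    _ ≤ ‖opSqrt A‖ * ‖opSqrt A‖ := norm_mul_le _ _
    _ ≤ √c * √c := by gcongr
    _ = c := Real.mul_self_sqrt hc

end Operators

section Preconditioners

variable {X : Type*} [NormedAddCommGroup X] [InnerProductSpace ℝ X] [FiniteDimensional ℝ X]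
variable {ℋ : Submodule ℝ (X →L[ℝ] X)}

/-! ### The Jordan algebra of preconditioners -/

theorem aeval_apply_of_eigenvector {A : X →L[ℝ] X} {c : ℝ} {x : X} (h : A x = c • x)
    (p : Polynomial ℝ) : Polynomial.aeval A p x = p.eval c • x := by
  induction p using Polynomial.induction_on' with
  | add p q hp hq => simp [hp, hq, add_smul]
  | monomial n a =>
    have hpow : ∀ n : ℕ, (A ^ n) x = c ^ n • x := fun n => by
      induction n with
      | zero => simp
      | succ n ih => rw [pow_succ, mul_apply_eq_comp, h, map_smul, ih, smul_smul,
          pow_succ, mul_comm]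
    rw [Polynomial.aeval_monomial, Polynomial.eval_monomial, mul_apply_eq_comp, hpow]
    simp [Algebra.algebraMap_eq_smul_one, smul_smul, mul_comm]

/-- Every operator acting diagonally in an eigenbasis of `A`, by a function of the eigenvalues, is
a polynomial in `A`, by Lagrange interpolation. -/
theorem exists_aeval_eq {A T : X →L[ℝ] X} (hA : (A : X →ₗ[ℝ] X).IsSymmetric) (φ : ℝ → ℝ)
    (hT : ∀ i, T (hA.eigenvectorBasis rfl i)
      = φ (hA.eigenvalues rfl i) • hA.eigenvectorBasis rfl i) :
    ∃ p : Polynomial ℝ, Polynomial.aeval A p = T := by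
  classical
  set s := Finset.univ.image (hA.eigenvalues rfl)
  refine ⟨Lagrange.interpolate s id φ, ?_⟩
  apply ContinuousLinearMap.coe_injective
  refine (hA.eigenvectorBasis rfl).toBasis.ext fun i => ?_
  have h := aeval_apply_of_eigenvector (A := A) (hA.apply_eigenvectorBasis rfl i)
    (Lagrange.interpolate s id φ)
  have h2 := Lagrange.eval_interpolate_at_node (s := s) (v := id) φ Function.injective_id.injOn
    (Finset.mem_image_of_mem _ (Finset.mem_univ i))
  simp only [id] at h2
  simp only [OrthonormalBasis.coe_toBasis, ContinuousLinearMap.coe_coe]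
  rw [hT i, h]
  congr 1

namespace IsPrecondSpace

theorem pow_mem (hℋ : IsPrecondSpace ℋ) {A : X →L[ℝ] X} (hA : A ∈ ℋ) (n : ℕ) : A ^ n ∈ ℋ := by
  induction n using Nat.twoStepInduction with
  | zero => simpa using hℋ.one_mem
  | one => simpa using hA
  | more n ih _ =>
    have := hℋ.mul_mul_mem A hA _ ih
    rwa [← pow_succ', ← pow_succ] at this

theorem aeval_mem (hℋ : IsPrecondSpace ℋ) {A : X →L[ℝ] X} (hA : A ∈ ℋ) (p : Polynomial ℝ) :
    Polynomial.aeval A p ∈ ℋ := by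
  rw [Polynomial.aeval_eq_sum_range]
  exact Submodule.sum_mem _ fun i _ => ℋ.smul_mem _ (hℋ.pow_mem hA i)

theorem opSqrt_mem (hℋ : IsPrecondSpace ℋ) {A : X →L[ℝ] X} (hA : A ∈ ℋ) : opSqrt A ∈ ℋ := by
  have hs := ContinuousLinearMap.isSelfAdjoint_iff_isSymmetric.1 (hℋ.isSelfAdjoint A hA)
  obtain ⟨p, hp⟩ := exists_aeval_eq (T := opSqrt A) hs Real.sqrt fun j => by
    unfold opSqrt
    rw [dif_pos hs]
    simp only [_root_.sum_apply, _root_.smul_apply, rankOne_apply]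
    rw [Finset.sum_eq_single j]
    · simp
    · intro i _ hij
      simp [(hs.eigenvectorBasis rfl).inner_eq_ite, hij]
    · simp
  exact hp ▸ hℋ.aeval_mem hA p

theorem inverse_mem (hℋ : IsPrecondSpace ℋ) {A : X →L[ℝ] X} (hA : A ∈ ℋ) (hpos : IsPosDef A) :
    Ring.inverse A ∈ ℋ := by
  have hs := ContinuousLinearMap.isSelfAdjoint_iff_isSymmetric.1 (hℋ.isSelfAdjoint A hA)
  obtain ⟨p, hp⟩ := exists_aeval_eq (T := Ring.inverse A) hs (fun t => t⁻¹) fun j => by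
    set b := hs.eigenvectorBasis rfl
    set c := hs.eigenvalues rfl j
    have h : A (b j) = c • b j := hs.apply_eigenvectorBasis rfl j
    have hc : c ≠ 0 := by
      intro hc
      have := hpos.2 (b j) (b.orthonormal.ne_zero j)
      simp [h, hc] at this
    have h2 : Ring.inverse A (A (b j)) = Ring.inverse A (c • b j) := by rw [h]
    rw [hpos.inverse_apply, map_smul] at h2
    exact (eq_inv_smul_iff₀ hc).2 h2.symm
  exact hp ▸ hℋ.aeval_mem hA p

/-! ### The projection onto the preconditioners -/

theorem tr_mul_proj (hℋ : IsPrecondSpace ℋ) {F M : X →L[ℝ] X} (hF : F ∈ ℋ)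
    (hM : IsSelfAdjoint M) : tr (F * proj ℋ M) = tr (F * M) := by
  have h := frobForm_sub_proj M hF
  rw [frobForm_apply, (hM.sub (hℋ.isSelfAdjoint _ (proj_mem ℋ M))).adjoint_eq, mul_sub, tr_sub]
    at h
  linarith

theorem tr_mul_proj_outer (hℋ : IsPrecondSpace ℋ) {F : X →L[ℝ] X} (hF : F ∈ ℋ) (z : X) :
    tr (F * proj ℋ (outer z)) = ⟪z, F z⟫ := by
  rw [hℋ.tr_mul_proj hF (isSelfAdjoint_outer z), tr_mul_outer]

theorem proj_of_mem {A : X →L[ℝ] X} (hA : A ∈ ℋ) : proj ℋ A = A :=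
  Submodule.projection_apply_of_mem_left (isCompl_orthogonal ℋ) hA

theorem eq_of_tr_mul_eq (hℋ : IsPrecondSpace ℋ) {A B : X →L[ℝ] X} (hA : A ∈ ℋ) (hB : B ∈ ℋ)
    (h : ∀ F ∈ ℋ, tr (F * A) = tr (F * B)) : A = B := by
  have hm := ℋ.sub_mem hA hB
  have h0 : frobForm (A - B) (A - B) = 0 := by
    rw [frobForm_apply, (hℋ.isSelfAdjoint _ hm).adjoint_eq, mul_sub, tr_sub, h _ hm, sub_self]
  exact sub_eq_zero.1 (frobForm_self_eq_zero h0)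

theorem proj_conj (hℋ : IsPrecondSpace ℋ) {A M : X →L[ℝ] X} (hA : A ∈ ℋ)
    (hM : IsSelfAdjoint M) : proj ℋ (A * M * A) = A * proj ℋ M * A := by
  have hAs := hℋ.isSelfAdjoint A hA
  refine hℋ.eq_of_tr_mul_eq (proj_mem _ _) (hℋ.mul_mul_mem A hA _ (proj_mem _ _)) fun F hF => ?_
  have cyc : ∀ N : X →L[ℝ] X, tr (F * (A * N * A)) = tr (A * F * A * N) := fun N => by
    rw [show F * (A * N * A) = (F * A * N) * A by noncomm_ring, tr_mul_comm]
    congr 1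
  rw [hℋ.tr_mul_proj hF (isSelfAdjoint_mul_mul hM hAs), cyc, cyc,
    hℋ.tr_mul_proj (hℋ.mul_mul_mem A hA F hF) hM]

theorem proj_isPositive (hℋ : IsPrecondSpace ℋ) {M : X →L[ℝ] X} (hM : M.IsPositive) :
    (proj ℋ M).IsPositive := by
  refine isPositive_iff_inner.2 ⟨hℋ.isSelfAdjoint _ (proj_mem _ _), fun x => ?_⟩
  have key : ∀ ε : ℝ, 0 < ε → 0 ≤ ⟪x, proj ℋ M x⟫ + ε * ‖x‖ ^ 2 := fun ε hε => by
    have h := hℋ.proj_posDef _ ((isPosDef_one.smul hε).add hM)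
    rw [map_add, map_smul, proj_of_mem hℋ.one_mem] at h
    have := h.isPositive.inner_nonneg_right x
    simp only [_root_.add_apply, _root_.smul_apply, one_apply_eq_self, inner_add_right,
      inner_smul_right, real_inner_self_eq_norm_sq] at this
    linarith
  refine le_of_forall_pos_le_add fun ε hε => ?_
  have h := key (ε / (‖x‖ ^ 2 + 1)) (by positivity)
  have h2 : ε / (‖x‖ ^ 2 + 1) * ‖x‖ ^ 2 ≤ ε := by
    rw [div_mul_eq_mul_div, div_le_iff₀ (by positivity)]
    nlinarith [sq_nonneg ‖x‖]
  linarith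

theorem proj_outer_isPositive (hℋ : IsPrecondSpace ℋ) (z : X) : (proj ℋ (outer z)).IsPositive :=
  hℋ.proj_isPositive (isPositive_outer z)

/-! ### The decision set -/

theorem mem_Q_iff (hℋ : IsPrecondSpace ℋ) {R : ℝ} (hR : 0 ≤ R) {x : X} :
    x ∈ Q ℋ R ↔ ∀ y, ⟪y, proj ℋ (outer x) y⟫ ≤ R ^ 2 * ‖y‖ ^ 2 :=
  norm_opSqrt_le_iff (hℋ.proj_outer_isPositive x) hR

theorem zero_mem_Q (hℋ : IsPrecondSpace ℋ) {R : ℝ} (hR : 0 ≤ R) : (0 : X) ∈ Q ℋ R := by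
  refine (hℋ.mem_Q_iff hR).2 fun y => ?_
  have : outer (0 : X) = 0 := by ext; simp [outer_apply]
  simp only [this, map_zero, _root_.zero_apply, inner_zero_right]
  positivity

theorem convex_Q (hℋ : IsPrecondSpace ℋ) {R : ℝ} (hR : 0 ≤ R) : Convex ℝ (Q ℋ R) := by
  intro x hx y hy a b ha hb hab
  rw [hℋ.mem_Q_iff hR] at hx hy ⊢
  intro v
  have hgap : a • outer x + b • outer y - outer (a • x + b • y) = (a * b) • outer (x - y) := by
    ext w
    obtain rfl : b = 1 - a := by linarith
    simp only [outer_apply, _root_.add_apply, _root_.sub_apply, _root_.smul_apply, inner_add_left,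
      inner_sub_left, inner_smul_left, conj_trivial]
    module
  have h1 := (hℋ.proj_isPositive ((isPositive_outer (x - y)).smul_of_nonneg
    (mul_nonneg ha hb))).inner_nonneg_right v
  rw [← hgap] at h1
  simp only [map_add, map_sub, map_smul, _root_.add_apply, _root_.sub_apply, _root_.smul_apply,
    inner_add_right, inner_sub_right, inner_smul_right] at h1
  have h2 := mul_le_mul_of_nonneg_left (hx v) ha
  have h3 := mul_le_mul_of_nonneg_left (hy v) hb
  have h4 : a * (R ^ 2 * ‖v‖ ^ 2) + b * (R ^ 2 * ‖v‖ ^ 2) = R ^ 2 * ‖v‖ ^ 2 := by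
    rw [← add_mul, hab, one_mul]
  linarith

/-- On `Q`, the quadratic form of `F ∈ ℋ` is controlled by the trace of `F`. -/
theorem inner_le_of_mem_Q (hℋ : IsPrecondSpace ℋ) {R : ℝ} (hR : 0 ≤ R) {x : X} (hx : x ∈ Q ℋ R)
    {F : X →L[ℝ] X} (hF : F ∈ ℋ) (hpos : F.IsPositive) : ⟪x, F x⟫ ≤ R ^ 2 * tr F := by
  set r := opSqrt F with hr
  have hr2 : r * r = F := opSqrt_mul_self hpos
  rw [← hℋ.tr_mul_proj_outer hF, ← hr2, mul_assoc, tr_mul_comm r, tr_mul_comm r]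
  set b := stdOrthonormalBasis ℝ X
  rw [tr_eq_sum b, tr_eq_sum b, Finset.mul_sum]
  refine Finset.sum_le_sum fun i _ => ?_
  have h := (hℋ.mem_Q_iff hR).1 hx (r (b i))
  rw [← real_inner_self_eq_norm_sq, inner_apply_left (opSqrt_isSelfAdjoint F),
    inner_apply_left (opSqrt_isSelfAdjoint F)] at h
  exact h

end IsPrecondSpace

end Preconditioners

section Regularizer

variable {X : Type*} [NormedAddCommGroup X] [InnerProductSpace ℝ X] [FiniteDimensional ℝ X]
variable {ℋ : Submodule ℝ (X →L[ℝ] X)}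

/-! ### The regularizer and its gradient -/

theorem tr_mul_nonneg {A B : X →L[ℝ] X} (hA : A.IsPositive) (hB : B.IsPositive) :
    0 ≤ tr (A * B) := by
  have h := tr_nonneg (isPositive_conj hA (opSqrt_isSelfAdjoint B))
  rwa [mul_assoc, tr_mul_comm, mul_assoc, opSqrt_mul_self hB] at h

/-- The preconditioner `√(proj_ℋ (m⟨m, ·⟩) + S)`, the operator whose trace is the regularizer. -/
noncomputable def prec (ℋ : Submodule ℝ (X →L[ℝ] X)) (S : X →L[ℝ] X) (m : X) : X →L[ℝ] X :=
  opSqrt (proj ℋ (outer m) + S)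

namespace IsPrecondSpace

variable {S : X →L[ℝ] X}

theorem isPosDef_proj_add (hℋ : IsPrecondSpace ℋ) (hpos : IsPosDef S) (m : X) :
    IsPosDef (proj ℋ (outer m) + S) := by
  rw [add_comm]
  exact hpos.add (hℋ.proj_outer_isPositive m)

theorem isPosDef_prec (hℋ : IsPrecondSpace ℋ) (hpos : IsPosDef S) (m : X) :
    IsPosDef (prec ℋ S m) :=
  (hℋ.isPosDef_proj_add hpos m).opSqrt

theorem prec_mem (hℋ : IsPrecondSpace ℋ) (hS : S ∈ ℋ) (m : X) : prec ℋ S m ∈ ℋ :=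
  hℋ.opSqrt_mem (ℋ.add_mem (proj_mem _ _) hS)

theorem prec_mul_self (hℋ : IsPrecondSpace ℋ) (hpos : IsPosDef S) (m : X) :
    prec ℋ S m * prec ℋ S m = proj ℋ (outer m) + S :=
  opSqrt_mul_self (hℋ.isPosDef_proj_add hpos m).isPositive

theorem Psi_eq (hℋ : IsPrecondSpace ℋ) (hpos : IsPosDef S) (η : ℝ) (m : X) :
    Psi η ℋ S m = η * tr (prec ℋ S m) := by
  rw [Psi, trNorm_opSqrt (hℋ.isPosDef_proj_add hpos m).isPositive, prec]

theorem inner_eq_tr_prec (hℋ : IsPrecondSpace ℋ) (hpos : IsPosDef S) {F : X →L[ℝ] X}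
    (hF : F ∈ ℋ) (m : X) :
    ⟪m, F m⟫ = tr (F * (prec ℋ S m * prec ℋ S m)) - tr (F * S) := by
  rw [hℋ.prec_mul_self hpos, mul_add, tr_add, hℋ.tr_mul_proj_outer hF]
  ring

theorem inner_inverse_prec (hℋ : IsPrecondSpace ℋ) (hS : S ∈ ℋ) (hpos : IsPosDef S) (m : X) :
    ⟪m, Ring.inverse (prec ℋ S m) m⟫
      = tr (prec ℋ S m) - tr (Ring.inverse (prec ℋ S m) * S) := by
  have hH := hℋ.isPosDef_prec hpos m
  rw [hℋ.inner_eq_tr_prec hpos (hℋ.inverse_mem (hℋ.prec_mem hS m) hH), ← mul_assoc,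
    hH.inverse_mul, one_mul]

theorem inner_conj_inverse_prec (hℋ : IsPrecondSpace ℋ) (hS : S ∈ ℋ) (hpos : IsPosDef S)
    {A : X →L[ℝ] X} (hA : A ∈ ℋ) (m : X) :
    ⟪Ring.inverse (prec ℋ S m) m, A (Ring.inverse (prec ℋ S m) m)⟫
      = tr A - tr (Ring.inverse (prec ℋ S m) * A * Ring.inverse (prec ℋ S m) * S) := by
  have hH := hℋ.isPosDef_prec hpos m
  have hm := hℋ.inverse_mem (hℋ.prec_mem hS m) hH
  have h := hℋ.inner_eq_tr_prec hpos (hℋ.mul_mul_mem _ hm _ hA) m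
  rw [inner_apply_left hH.inverse.1]
  set H := prec ℋ S m
  have e : Ring.inverse H * A * Ring.inverse H * (H * H) = Ring.inverse H * A * H := by
    rw [show Ring.inverse H * A * Ring.inverse H * (H * H)
      = Ring.inverse H * A * (Ring.inverse H * H) * H by noncomm_ring, hH.inverse_mul, mul_one]
  rw [e, tr_mul_comm, ← mul_assoc, hH.mul_inverse, one_mul] at h
  exact h

/-- Convexity of `m ↦ tr (prec ℋ S m)`, in first-order form. -/
theorem tr_prec_add_inner_le (hℋ : IsPrecondSpace ℋ) (hS : S ∈ ℋ) (hpos : IsPosDef S) (p q : X) :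
    tr (prec ℋ S p) + ⟪Ring.inverse (prec ℋ S p) p, q - p⟫ ≤ tr (prec ℋ S q) := by
  have hH := hℋ.isPosDef_prec hpos p
  have hN := hℋ.isPosDef_prec hpos q
  have a1 := hℋ.inner_inverse_prec hS hpos p
  have a2 := two_inner_le_add_inverse hN (Ring.inverse (prec ℋ S p) p) q
  have a3 := hℋ.inner_conj_inverse_prec hS hpos (hℋ.prec_mem hS q) p
  have a4 := hℋ.inner_inverse_prec hS hpos q
  set H := prec ℋ S p
  set N := prec ℋ S q
  have hK : (Ring.inverse H * N * Ring.inverse H - (2 : ℝ) • Ring.inverse H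
      + Ring.inverse N).IsPositive := by
    refine isPositive_iff_inner.2 ⟨?_, fun x => ?_⟩
    · exact ((isSelfAdjoint_mul_mul hN.1 hH.inverse.1).sub
        (hH.inverse.smul two_pos).1).add hN.inverse.1
    · have h := two_inner_le_add_inverse hN (Ring.inverse H x) x
      rw [inner_apply_left hH.inverse.1, inner_apply_left hH.inverse.1] at h
      simp only [_root_.add_apply, _root_.sub_apply, _root_.smul_apply, mul_apply_eq_comp,
        inner_add_right, inner_sub_right, inner_smul_right]
      linarith
  have a5 := tr_mul_nonneg hK hpos.isPositive
  simp only [add_mul, sub_mul, tr_add, tr_sub, smul_mul_assoc, tr_smul] at a5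
  rw [inner_sub_right, real_inner_comm p]
  linarith

/-- The quadratic upper bound matching `tr_prec_add_inner_le`. -/
theorem tr_prec_le (hℋ : IsPrecondSpace ℋ) (hS : S ∈ ℋ) (hpos : IsPosDef S) (p q : X) :
    tr (prec ℋ S q) ≤ tr (prec ℋ S p) + ⟪Ring.inverse (prec ℋ S p) p, q - p⟫
      + ⟪q - p, Ring.inverse (prec ℋ S p) (q - p)⟫ / 2 := by
  have hH := hℋ.isPosDef_prec hpos p
  have a1 := hℋ.inner_inverse_prec hS hpos p
  have a2 := two_tr_opSqrt_le (hℋ.isPosDef_proj_add hpos q).isPositive hH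
  rw [mul_add, tr_add, hℋ.tr_mul_proj_outer (hℋ.inverse_mem (hℋ.prec_mem hS p) hH)] at a2
  change 2 * tr (prec ℋ S q) ≤ _ at a2
  set H := prec ℋ S p
  have e : ⟪p, Ring.inverse H q⟫ = ⟪q, Ring.inverse H p⟫ := by
    rw [← inner_apply_left hH.inverse.1, real_inner_comm]
  have e2 : ⟪Ring.inverse H p, q⟫ = ⟪q, Ring.inverse H p⟫ := real_inner_comm _ _
  have e3 : ⟪Ring.inverse H p, p⟫ = ⟪p, Ring.inverse H p⟫ := real_inner_comm _ _
  simp only [map_sub, inner_sub_left, inner_sub_right, e, e2, e3]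
  linarith

theorem hasGradientAt_Psi (hℋ : IsPrecondSpace ℋ) (hS : S ∈ ℋ) (hpos : IsPosDef S) {η : ℝ}
    (hη : 0 ≤ η) (p : X) :
    HasGradientAt (Psi η ℋ S) (η • Ring.inverse (prec ℋ S p) p) p := by
  rw [hasGradientAt_iff_isLittleO]
  refine Asymptotics.IsBigO.trans_isLittleO (g := fun q => ‖q - p‖ ^ 2) ?_ ?_
  · refine Asymptotics.IsBigO.of_bound (η * ‖Ring.inverse (prec ℋ S p)‖) (.of_forall fun q => ?_)
    have h1 := mul_le_mul_of_nonneg_left (hℋ.tr_prec_add_inner_le hS hpos p q) hη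
    have h2 := mul_le_mul_of_nonneg_left (hℋ.tr_prec_le hS hpos p q) hη
    rw [hℋ.Psi_eq hpos, hℋ.Psi_eq hpos, inner_smul_left]
    set H := prec ℋ S p
    have h3 : ⟪q - p, Ring.inverse H (q - p)⟫ ≤ ‖Ring.inverse H‖ * ‖q - p‖ ^ 2 :=
      calc _ ≤ ‖q - p‖ * ‖Ring.inverse H (q - p)‖ := real_inner_le_norm _ _
        _ ≤ ‖q - p‖ * (‖Ring.inverse H‖ * ‖q - p‖) := by gcongr; exact (Ring.inverse H).le_opNorm _
        _ = _ := by ring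
    have h4 := mul_le_mul_of_nonneg_left h3 hη
    have h5 : 0 ≤ η * (‖Ring.inverse H‖ * ‖q - p‖ ^ 2) := by positivity
    simp only [conj_trivial, Real.norm_eq_abs, abs_pow, abs_norm]
    rw [abs_le]
    constructor <;> linarith
  · have h : Filter.Tendsto (fun q => q - p) (nhds p) (nhds 0) := by
      rw [← sub_self p]
      exact Filter.tendsto_id.sub_const p
    have h2 := (Asymptotics.isLittleO_norm_pow_id (E' := X) one_lt_two).comp_tendsto h
    exact h2

theorem gradient_Psi (hℋ : IsPrecondSpace ℋ) (hS : S ∈ ℋ) (hpos : IsPosDef S) {η : ℝ}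
    (hη : 0 ≤ η) (p : X) : ∇ (Psi η ℋ S) p = η • Ring.inverse (prec ℋ S p) p :=
  (hℋ.hasGradientAt_Psi hS hpos hη p).gradient

theorem neg_gradient_Psi_mem_Q (hℋ : IsPrecondSpace ℋ) (hS : S ∈ ℋ) (hpos : IsPosDef S) {η : ℝ}
    (hη : 0 ≤ η) (p : X) : -∇ (Psi η ℋ S) p ∈ Q ℋ η := by
  have hH := hℋ.isPosDef_prec hpos p
  have hsq := hℋ.prec_mul_self hpos p
  have hm := hℋ.inverse_mem (hℋ.prec_mem hS p) hH
  rw [hℋ.gradient_Psi hS hpos hη, hℋ.mem_Q_iff hη, ← neg_smul, outer_smul,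
    outer_apply_eq_conj hH.inverse.1, map_smul, hℋ.proj_conj hm (isSelfAdjoint_outer p)]
  set H := prec ℋ S p
  intro y
  have h1 := hpos.isPositive.inner_nonneg_right (Ring.inverse H y)
  have h2 : proj ℋ (outer p) = H * H - S := by rw [hsq]; abel
  have h3 : ⟪y, (Ring.inverse H * (H * H - S) * Ring.inverse H) y⟫
      = ‖y‖ ^ 2 - ⟪Ring.inverse H y, S (Ring.inverse H y)⟫ := by
    simp only [mul_apply_eq_comp, _root_.sub_apply, map_sub, hH.apply_inverse, hH.inverse_apply,
      inner_sub_right, real_inner_self_eq_norm_sq, inner_apply_left hH.inverse.1]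
  rw [h2, _root_.smul_apply, inner_smul_right, h3, neg_sq]
  nlinarith [sq_nonneg η]

/-- `R tr √(…)` dominates the support function of `Q`. -/
theorem neg_inner_le_Psi (hℋ : IsPrecondSpace ℋ) (hS : S ∈ ℋ) (hpos : IsPosDef S) {R : ℝ}
    (hR : 0 < R) {x : X} (hx : x ∈ Q ℋ R) (m : X) : -⟪m, x⟫ ≤ Psi R ℋ S m := by
  have hN := hℋ.isPosDef_prec hpos m
  have h1 := two_inner_le_add_inverse hN x (-R • m)
  have h2 := hℋ.inner_le_of_mem_Q hR.le hx (hℋ.prec_mem hS m) hN.isPositive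
  have h3 := hℋ.inner_inverse_prec hS hpos m
  have h4 := tr_mul_nonneg hN.inverse.isPositive hpos.isPositive
  rw [hℋ.Psi_eq hpos]
  simp only [map_smul, inner_smul_left, inner_smul_right, conj_trivial, h3] at h1
  rw [real_inner_comm x m] at *
  have h5 : R * (-⟪x, m⟫) ≤ R * (R * tr (prec ℋ S m)) := by
    nlinarith [mul_nonneg (sq_nonneg R) h4]
  exact le_of_mul_le_mul_left h5 hR

/-- The stability estimate: the Bregman divergence of the regularizer from `p` to `p - d`, with
`S` increased meanwhile by the contribution of `c`, is at most three times the growth of `tr √S`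
caused by `c` and `d`. The variational formula is applied with the competitor `Z = H + W`, where
`H = prec ℋ S p` and `W` is the growth of `√S`. -/
theorem tr_prec_step (hℋ : IsPrecondSpace ℋ) (hS : S ∈ ℋ) (hpos : IsPosDef S) (c d p : X) :
    tr (prec ℋ (S + proj ℋ (outer c)) (p - d)) - tr (prec ℋ S p)
        + ⟪Ring.inverse (prec ℋ S p) p, d⟫
      ≤ 3 * (tr (opSqrt (S + proj ℋ (outer c) + proj ℋ (outer d))) - tr (opSqrt S)) := by
  have hc := hℋ.proj_outer_isPositive c
  have hd := hℋ.proj_outer_isPositive d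
  have hS1 : IsPosDef (S + proj ℋ (outer c)) := hpos.add hc
  have hS2 : IsPosDef (S + proj ℋ (outer c) + proj ℋ (outer d)) := hS1.add hd
  have hS2m : S + proj ℋ (outer c) + proj ℋ (outer d) ∈ ℋ :=
    ℋ.add_mem (ℋ.add_mem hS (proj_mem _ _)) (proj_mem _ _)
  have hH := hℋ.isPosDef_prec hpos p
  have hHm := hℋ.prec_mem hS p
  have hD := hS2.opSqrt
  have hDm := hℋ.opSqrt_mem hS2m
  have hDsq := opSqrt_mul_self hS2.isPositive
  have hW : (opSqrt (S + proj ℋ (outer c) + proj ℋ (outer d)) - opSqrt S).IsPositive := by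
    refine opSqrt_sub_isPositive hpos.isPositive hS2 ?_
    rw [show S + proj ℋ (outer c) + proj ℋ (outer d) - S
      = proj ℋ (outer c) + proj ℋ (outer d) by abel]
    exact hc.add hd
  have hWm := ℋ.sub_mem hDm (hℋ.opSqrt_mem hS)
  have hHs : (prec ℋ S p - opSqrt S).IsPositive := by
    refine opSqrt_sub_isPositive hpos.isPositive (hℋ.isPosDef_proj_add hpos p) ?_
    rw [add_sub_cancel_right]
    exact hℋ.proj_outer_isPositive p
  have t0 := two_tr_opSqrt_le hpos.isPositive hD
  have t1 := hℋ.inner_conj_inverse_prec hS hpos hWm p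
  have t1' := tr_mul_nonneg (isPositive_conj hW hH.inverse.1) hpos.isPositive
  have t2 : tr (opSqrt (S + proj ℋ (outer c) + proj ℋ (outer d)) - opSqrt S)
    = tr (opSqrt (S + proj ℋ (outer c) + proj ℋ (outer d))) - tr (opSqrt S) := tr_sub _ _
  have t3 : ∀ F ∈ ℋ, ⟪p, F p⟫ = tr (F * (prec ℋ S p * prec ℋ S p)) - tr (F * S) :=
    fun F hF => hℋ.inner_eq_tr_prec hpos hF p
  have hprec : 2 * tr (prec ℋ (S + proj ℋ (outer c)) (p - d)) ≤ _ :=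
    two_tr_opSqrt_le (hℋ.isPosDef_proj_add hS1 (p - d)).isPositive (hH.add hW)
  set D := opSqrt (S + proj ℋ (outer c) + proj ℋ (outer d))
  set W := D - opSqrt S
  set H := prec ℋ S p
  set Z := H + W
  have hZ : IsPosDef Z := hH.add hW
  have hZm : Z ∈ ℋ := ℋ.add_mem hHm hWm
  have hZi := hℋ.inverse_mem hZm hZ
  have hDi := hℋ.inverse_mem hDm hD
  have hZD : (Z - D).IsPositive := by
    rw [show Z - D = H - opSqrt S by simp only [Z, W]; abel]
    exact hHs
  have hZW : (Z - W).IsPositive := by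
    rw [show Z - W = H by simp only [Z]; abel]
    exact hH.isPositive
  -- the quadratic forms of `c` and `d` in the metric `Z⁻¹ ≤ D⁻¹`
  have q1 : ⟪d, Ring.inverse Z d⟫ + ⟪c, Ring.inverse Z c⟫ ≤ 2 * tr W := by
    have h1 := inner_inverse_le hD hZ hZD d
    have h2 := inner_inverse_le hD hZ hZD c
    have h3 : ⟪d, Ring.inverse D d⟫ + ⟪c, Ring.inverse D c⟫
        = tr D - tr (Ring.inverse D * S) := by
      rw [← hℋ.tr_mul_proj_outer hDi, ← hℋ.tr_mul_proj_outer hDi]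
      have : tr (Ring.inverse D * (D * D)) = tr D := by
        rw [← mul_assoc, hD.inverse_mul, one_mul]
      rw [hDsq, mul_add, mul_add, tr_add, tr_add] at this
      linarith
    linarith
  have q2 : tr (Ring.inverse Z * (W * W)) ≤ tr W := by
    rw [← mul_assoc, tr_mul_comm, tr_eq_sum (stdOrthonormalBasis ℝ X),
      tr_eq_sum (stdOrthonormalBasis ℝ X)]
    refine Finset.sum_le_sum fun i _ => ?_
    have h := inner_inverse_apply_le hW hZ hZW (stdOrthonormalBasis ℝ X i)
    rwa [inner_apply_left hW.isSelfAdjoint] at h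
  have q3 : tr (Ring.inverse Z * (H * H)) = tr Z - 2 * tr W + tr (Ring.inverse Z * (W * W)) := by
    have e : Ring.inverse Z * (H * H) = Ring.inverse Z * Z * Z - Ring.inverse Z * Z * W
        - Ring.inverse Z * (W * Z) + Ring.inverse Z * (W * W) := by
      rw [show H = Z - W by simp only [Z]; abel]
      noncomm_ring
    rw [e, hZ.inverse_mul, one_mul, one_mul, tr_add, tr_sub, tr_sub, tr_mul_comm _ (W * Z),
      mul_assoc W, hZ.mul_inverse, mul_one]
    ring
  have q4 : tr Z = tr H + tr W := tr_add _ _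
  -- the cross term
  have q5 : ⟪Ring.inverse H p, d⟫ - ⟪p, Ring.inverse Z d⟫
      = ⟪Ring.inverse H p, W (Ring.inverse Z d)⟫ := by
    have h : W (Ring.inverse Z d) = d - H (Ring.inverse Z d) := by
      rw [show W = Z - H by simp only [Z]; abel, _root_.sub_apply, hZ.apply_inverse]
    rw [h, inner_sub_right, ← inner_apply_left hH.1, hH.apply_inverse]
  have q6 := two_inner_le hW (Ring.inverse H p) (Ring.inverse Z d)
  have q7 : ⟪Ring.inverse Z d, W (Ring.inverse Z d)⟫ ≤ ⟪d, Ring.inverse Z d⟫ := by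
    have h := hZW.inner_nonneg_right (Ring.inverse Z d)
    rw [_root_.sub_apply, inner_sub_right, hZ.apply_inverse, real_inner_comm d] at h
    linarith
  have q8 : 0 ≤ ⟪c, Ring.inverse Z c⟫ := hZ.inverse.isPositive.inner_nonneg_right c
  rw [mul_add, mul_add, tr_add, tr_add, hℋ.tr_mul_proj_outer hZi, hℋ.tr_mul_proj_outer hZi]
    at hprec
  have q9 : ⟪d, Ring.inverse Z p⟫ = ⟪p, Ring.inverse Z d⟫ := by
    rw [← inner_apply_left hZ.inverse.1, real_inner_comm]
  simp only [map_sub, inner_sub_left, inner_sub_right, q9, t3 _ hZi] at hprec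
  linarith

end IsPrecondSpace

end Regularizer

section Regret

variable {X : Type*} [NormedAddCommGroup X] [InnerProductSpace ℝ X] [FiniteDimensional ℝ X]
variable {ℋ : Submodule ℝ (X →L[ℝ] X)}

/-! ### The regret bound -/

namespace IsPrecondSpace

/-- One step of the regret bound. Convexity of the new regularizer, applied between the new dual
point `p + g` and the virtual point `p - d`, turns the left-hand side into the quantity bounded by
`tr_prec_step`. -/
theorem regret_step (hℋ : IsPrecondSpace ℋ) {S : X →L[ℝ] X} (hS : S ∈ ℋ) (hpos : IsPosDef S)
    {R : ℝ} (hR : 0 ≤ R) (c d g p : X) :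
    ⟪g, -∇ (Psi R ℋ (S + proj ℋ (outer c))) (p + g)⟫
        + ⟪d, -∇ (Psi R ℋ (S + proj ℋ (outer c))) (p + g) - -∇ (Psi R ℋ S) p⟫
        + Psi R ℋ (S + proj ℋ (outer c)) (p + g)
      ≤ Psi R ℋ S p
        + 3 * R * (tr (opSqrt (S + proj ℋ (outer c) + proj ℋ (outer d))) - tr (opSqrt S)) := by
  have hS1 : S + proj ℋ (outer c) ∈ ℋ := ℋ.add_mem hS (proj_mem _ _)
  have hpos1 : IsPosDef (S + proj ℋ (outer c)) := hpos.add (hℋ.proj_outer_isPositive c)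
  have h1 := mul_le_mul_of_nonneg_left (hℋ.tr_prec_add_inner_le hS1 hpos1 (p + g) (p - d)) hR
  have h2 := mul_le_mul_of_nonneg_left (hℋ.tr_prec_step hS hpos c d p) hR
  rw [hℋ.gradient_Psi hS1 hpos1 hR, hℋ.gradient_Psi hS hpos hR, hℋ.Psi_eq hpos1, hℋ.Psi_eq hpos]
  set u := Ring.inverse (prec ℋ (S + proj ℋ (outer c)) (p + g)) (p + g)
  set v := Ring.inverse (prec ℋ S p) p
  have e : p - d - (p + g) = -(d + g) := by abel
  rw [e] at h1
  simp only [inner_neg_right, inner_add_right, inner_sub_right, inner_smul_right,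
    real_inner_comm u, real_inner_comm v] at h1 h2 ⊢
  rw [real_inner_comm d u, real_inner_comm g u] at *
  linarith

variable {S : ℕ → X →L[ℝ] X} {m x g d : ℕ → X} {R : ℝ}

theorem sum_regret_add_Psi_le (hℋ : IsPrecondSpace ℋ) (hS : ∀ k, S k ∈ ℋ)
    (hpos : ∀ k, IsPosDef (S k)) (hR : 0 ≤ R) (hm0 : m 0 = 0) (hx0 : x 0 = 0)
    (hm : ∀ k, m (k + 1) = m k + g k) (hx : ∀ k, x (k + 1) = -∇ (Psi R ℋ (S k)) (m (k + 1)))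
    (hSs : ∀ k, S (k + 1) = S k + proj ℋ (outer (d k))) (n : ℕ) :
    ∑ k ∈ Finset.range (n + 1), (⟪g k, x (k + 1)⟫ + ⟪d k, x (k + 1) - x k⟫)
        + Psi R ℋ (S n) (m (n + 1))
      ≤ 3 * R * (tr (opSqrt (S (n + 1))) + tr (opSqrt (S n))) := by
  induction n with
  | zero =>
    have h := hℋ.regret_step (hS 0) (hpos 0) hR 0 (d 0) (g 0) (m 0)
    have e0 : outer (0 : X) = 0 := by ext; simp [outer_apply]
    have e1 : -∇ (Psi R ℋ (S 0)) (m 0) = x 0 := by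
      rw [hℋ.gradient_Psi (hS 0) (hpos 0) hR, hm0, hx0]
      simp
    have e2 : Psi R ℋ (S 0) (m 0) = R * tr (opSqrt (S 0)) := by
      rw [hℋ.Psi_eq (hpos 0), prec, hm0, e0, map_zero, zero_add]
    rw [e1, e2, e0, map_zero, add_zero, ← hm, ← hx, ← hSs] at h
    have h3 := mul_nonneg hR (tr_nonneg (opSqrt_isPositive (S 0)))
    simp only [zero_add, Finset.range_one, Finset.sum_singleton] at h ⊢
    linarith
  | succ n ih =>
    have h := hℋ.regret_step (hS n) (hpos n) hR (d n) (d (n + 1)) (g (n + 1)) (m (n + 1))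
    rw [← hx n, ← hm, ← hSs, ← hx, ← hSs] at h
    rw [Finset.sum_range_succ]
    linarith

theorem sum_regret_le (hℋ : IsPrecondSpace ℋ) (hS : ∀ k, S k ∈ ℋ)
    (hpos : ∀ k, IsPosDef (S k)) (hR : 0 < R) (hm0 : m 0 = 0) (hx0 : x 0 = 0)
    (hm : ∀ k, m (k + 1) = m k + g k) (hx : ∀ k, x (k + 1) = -∇ (Psi R ℋ (S k)) (m (k + 1)))
    (hSs : ∀ k, S (k + 1) = S k + proj ℋ (outer (d k))) {xs : X} (hxs : xs ∈ Q ℋ R) (n : ℕ) :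
    ∑ k ∈ Finset.range (n + 1), (⟪g k, x (k + 1) - xs⟫ + ⟪d k, x (k + 1) - x k⟫)
      ≤ 6 * R * tr (opSqrt (S (n + 1))) := by
  have h1 := hℋ.sum_regret_add_Psi_le hS hpos hR.le hm0 hx0 hm hx hSs n
  have h2 := hℋ.neg_inner_le_Psi (hS n) (hpos n) hR hxs (m (n + 1))
  have hsum : ∀ j, m j = ∑ k ∈ Finset.range j, g k := fun j => by
    induction j with
    | zero => simpa using hm0
    | succ j ih => rw [hm, ih, Finset.sum_range_succ]
  have h3 : tr (opSqrt (S n)) ≤ tr (opSqrt (S (n + 1))) := by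
    have h := tr_nonneg (opSqrt_sub_isPositive (hpos n).isPositive (hpos (n + 1)) (by
      rw [hSs, add_sub_cancel_left]
      exact hℋ.proj_outer_isPositive _))
    rw [tr_sub] at h
    linarith
  have h4 : ∑ k ∈ Finset.range (n + 1), (⟪g k, x (k + 1) - xs⟫ + ⟪d k, x (k + 1) - x k⟫)
      = ∑ k ∈ Finset.range (n + 1), (⟪g k, x (k + 1)⟫ + ⟪d k, x (k + 1) - x k⟫)
        - ⟪m (n + 1), xs⟫ := by
    rw [hsum, sum_inner, ← Finset.sum_sub_distrib]
    exact Finset.sum_congr rfl fun k _ => by rw [inner_sub_right (g k)]; ring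
  have h5 := mul_le_mul_of_nonneg_left h3 hR.le
  linarith

/-- The trace of `√S`, bounded by the variational formula with the competitor `δ + c B`. -/
theorem two_tr_opSqrt_sum_le (hℋ : IsPrecondSpace ℋ) {B : X →L[ℝ] X} (hBm : B ∈ ℋ)
    (hB : IsPosDef B) (htr : tr B = 1) {δ c : ℝ} (hδ : 0 < δ) (hc : 0 < c)
    (hS0 : S 0 = δ ^ 2 • 1) (hSs : ∀ k, S (k + 1) = S k + proj ℋ (outer (d k))) (n : ℕ) :
    2 * tr (opSqrt (S n)) ≤ 2 * (δ * Module.finrank ℝ X) + c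
      + c⁻¹ * ∑ k ∈ Finset.range n, ⟪d k, Ring.inverse B (d k)⟫ := by
  have hδ1 : IsPosDef (δ • (1 : X →L[ℝ] X)) := isPosDef_one.smul hδ
  have hcB : IsPosDef (c • B) := hB.smul hc
  have hZ : IsPosDef (δ • (1 : X →L[ℝ] X) + c • B) := hδ1.add hcB.isPositive
  have hZm : δ • (1 : X →L[ℝ] X) + c • B ∈ ℋ :=
    ℋ.add_mem (ℋ.smul_mem _ hℋ.one_mem) (ℋ.smul_mem _ hBm)
  have hZ1 : (δ • (1 : X →L[ℝ] X) + c • B - δ • 1).IsPositive := by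
    rw [add_sub_cancel_left]; exact hcB.isPositive
  have hZ2 : (δ • (1 : X →L[ℝ] X) + c • B - c • B).IsPositive := by
    rw [add_sub_cancel_right]; exact hδ1.isPositive
  have htrZ : tr (δ • (1 : X →L[ℝ] X) + c • B) = δ * Module.finrank ℝ X + c := by
    rw [tr_add, tr_smul, tr_smul, tr_one, htr, mul_one]
  set Z := δ • (1 : X →L[ℝ] X) + c • B
  have hZi := hℋ.inverse_mem hZm hZ
  have hSn : (S n).IsPositive ∧ tr (Ring.inverse Z * S n)
      = δ ^ 2 * tr (Ring.inverse Z) + ∑ k ∈ Finset.range n, ⟪d k, Ring.inverse Z (d k)⟫ := by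
    induction n with
    | zero =>
      rw [hS0]
      exact ⟨ContinuousLinearMap.isPositive_one.smul_of_nonneg (sq_nonneg δ), by
        rw [mul_smul_comm, mul_one, tr_smul]; simp⟩
    | succ n ih =>
      rw [hSs]
      refine ⟨ih.1.add (hℋ.proj_outer_isPositive _), ?_⟩
      rw [mul_add, tr_add, ih.2, hℋ.tr_mul_proj_outer hZi, Finset.sum_range_succ]
      ring
  have h1 := two_tr_opSqrt_le hSn.1 hZ
  have h2 : δ ^ 2 * tr (Ring.inverse Z) ≤ δ * Module.finrank ℝ X := by
    rw [tr_eq_sum (stdOrthonormalBasis ℝ X), Finset.mul_sum]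
    calc ∑ i, δ ^ 2 * ⟪stdOrthonormalBasis ℝ X i, Ring.inverse Z (stdOrthonormalBasis ℝ X i)⟫
        ≤ ∑ _i : Fin (Module.finrank ℝ X), δ := by
          refine Finset.sum_le_sum fun i _ => ?_
          have h := inner_inverse_apply_le hδ1.isPositive hZ hZ1 (stdOrthonormalBasis ℝ X i)
          simp only [_root_.smul_apply, one_apply_eq_self, map_smul, inner_smul_left,
            inner_smul_right, conj_trivial, real_inner_self_eq_norm_sq,
            OrthonormalBasis.norm_eq_one] at h
          linarith
      _ = δ * Module.finrank ℝ X := by simp [mul_comm]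
  have h3 : ∑ k ∈ Finset.range n, ⟪d k, Ring.inverse Z (d k)⟫
      ≤ c⁻¹ * ∑ k ∈ Finset.range n, ⟪d k, Ring.inverse B (d k)⟫ := by
    rw [Finset.mul_sum]
    refine Finset.sum_le_sum fun k _ => ?_
    have h := inner_inverse_apply_le hcB.isPositive hZ hZ2 (c⁻¹ • Ring.inverse B (d k))
    rw [_root_.smul_apply, map_smul, smul_smul, mul_inv_cancel₀ hc.ne', one_smul,
      hB.apply_inverse, inner_smul_left, conj_trivial, real_inner_comm (d k)] at h
    exact h
  linarith [hSn.2]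

end IsPrecondSpace

end Regret

section Smoothness

variable {X : Type*} [NormedAddCommGroup X] [InnerProductSpace ℝ X] [FiniteDimensional ℝ X]
variable {B : X →L[ℝ] X} {f : X → ℝ} {gradf : X → X} {L ν ρ : ℝ}

/-! ### Hölder smoothness as inexact smoothness -/

theorem wnorm_nonneg (H : X →L[ℝ] X) (x : X) : 0 ≤ wnorm H x := Real.sqrt_nonneg _

theorem wnorm_sq (hB : B.IsPositive) (x : X) : wnorm B x ^ 2 = ⟪x, B x⟫ :=
  Real.sq_sqrt (hB.inner_nonneg_right x)

theorem inner_le_wnorm_mul (hB : IsPosDef B) (u v : X) :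
    ⟪u, v⟫ ≤ wnorm (Ring.inverse B) u * wnorm B v := by
  have key : ∀ t : ℝ, 0 ≤ wnorm B v ^ 2 * (t * t) + (-2 * ⟪u, v⟫) * t
      + wnorm (Ring.inverse B) u ^ 2 := fun t => by
    have h := two_inner_le_add_inverse hB (t • v) u
    rw [wnorm_sq hB.isPositive, wnorm_sq hB.inverse.isPositive]
    simp only [map_smul, inner_smul_left, inner_smul_right, conj_trivial, real_inner_comm u v] at h
    linarith
  have h := discrim_le_zero key
  rw [discrim] at h
  refine le_of_sq_le_sq (by nlinarith) (mul_nonneg (wnorm_nonneg _ _) (wnorm_nonneg _ _))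

theorem rpow_mul_self_le (hρ : 0 < ρ) (hν : 0 ≤ ν) (hν1 : ν ≤ 1) {r : ℝ} (hr : 0 ≤ r) :
    r ^ ν * r ≤ ρ ^ (ν - 1) * (r ^ 2 + ρ ^ 2) := by
  have hp : 0 < ρ ^ (ν - 1) := Real.rpow_pos_of_pos hρ _
  rcases le_total r ρ with h | h
  · calc r ^ ν * r ≤ ρ ^ ν * ρ := by gcongr
      _ = ρ ^ (ν - 1) * ρ ^ 2 := by rw [Real.rpow_sub_one hρ.ne']; field_simp
      _ ≤ _ := by gcongr; nlinarith
  · have hr0 : 0 < r := hρ.trans_le h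
    calc r ^ ν * r = r ^ (ν - 1) * r ^ 2 := by rw [Real.rpow_sub_one hr0.ne']; field_simp
      _ ≤ ρ ^ (ν - 1) * r ^ 2 := by
        exact mul_le_mul_of_nonneg_right
          (Real.rpow_le_rpow_of_nonpos hρ h (sub_nonpos.2 hν1)) (sq_nonneg r)
      _ ≤ _ := by gcongr; nlinarith

/-- A Hölder smooth function is smooth up to an additive error, with a trade-off parameter `ρ`
that may be chosen freely. -/
theorem IsHolderSmooth.le_quadratic (hf : IsHolderSmooth f B L ν) (hB : IsPosDef B)
    (hg : ∀ x, IsSubgradient f x (gradf x)) (hL : 0 ≤ L) (hρ : 0 < ρ) (hν : 0 ≤ ν) (hν1 : ν ≤ 1)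
    (x y : X) :
    f y ≤ f x + ⟪gradf x, y - x⟫ + L * ρ ^ (ν - 1) * (⟪y - x, B (y - x)⟫ + ρ ^ 2) := by
  have h1 := hg y x
  have h2 := inner_le_wnorm_mul hB (gradf y - gradf x) (y - x)
  have h3 := mul_le_mul_of_nonneg_right (hf y x _ _ (hg y) (hg x)) (wnorm_nonneg B (y - x))
  have h4 := mul_le_mul_of_nonneg_left (rpow_mul_self_le hρ hν hν1 (wnorm_nonneg B (y - x))) hL
  rw [wnorm_sq hB.isPositive] at h4
  rw [← neg_sub y x, inner_neg_right] at h1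
  rw [inner_sub_left] at h2
  linarith

/-- Inexact co-coercivity of the subgradients: `f x` is compared with the value of `f` after a
gradient step from `y` for the tilted function `f - ⟪gradf x, ·⟫`. -/
theorem IsHolderSmooth.cocoercive (hf : IsHolderSmooth f B L ν) (hB : IsPosDef B)
    (hg : ∀ x, IsSubgradient f x (gradf x)) (hL : 0 < L) (hρ : 0 < ρ) (hν : 0 ≤ ν) (hν1 : ν ≤ 1)
    (x y : X) :
    f x ≤ f y + ⟪gradf x, x - y⟫
      - (4 * (L * ρ ^ (ν - 1)))⁻¹ * ⟪gradf x - gradf y, Ring.inverse B (gradf x - gradf y)⟫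
      + L * ρ ^ (ν - 1) * ρ ^ 2 := by
  have hM : 0 < L * ρ ^ (ν - 1) := mul_pos hL (Real.rpow_pos_of_pos hρ _)
  set M := L * ρ ^ (ν - 1)
  set u := gradf x - gradf y with hu
  set w := Ring.inverse B u
  -- the step size minimising `-t ⟪u, w⟫ + M t² ⟪u, w⟫`
  set t : ℝ := (2 * M)⁻¹
  have h1 := hg x (y + t • w)
  have h2 := hf.le_quadratic hB hg hL.le hρ hν hν1 y (y + t • w)
  rw [add_sub_cancel_left, map_smul, hB.apply_inverse, inner_smul_left, inner_smul_right,
    inner_smul_right, conj_trivial, real_inner_comm u w] at h2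
  have e1 : y + t • w - x = t • w - (x - y) := by abel
  rw [e1, inner_sub_right, inner_smul_right] at h1
  have e2 : ⟪u, w⟫ = ⟪gradf x, w⟫ - ⟪gradf y, w⟫ := by rw [hu, inner_sub_left]
  have e3 : t * ⟪u, w⟫ = t * ⟪gradf x, w⟫ - t * ⟪gradf y, w⟫ := by rw [e2]; ring
  have e4 : M * (t * (t * ⟪u, w⟫)) = t * ⟪u, w⟫ - (4 * M)⁻¹ * ⟪u, w⟫ := by
    simp only [t]; field_simp; ring
  have h2' : f (y + t • w) ≤ f y + t * ⟪gradf y, w⟫ + M * (t * (t * ⟪u, w⟫)) + M * ρ ^ 2 := by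
    linarith
  linarith

end Smoothness

section Pathwise

variable {X : Type*} [NormedAddCommGroup X] [InnerProductSpace ℝ X] [FiniteDimensional ℝ X]
variable {ℋ : Submodule ℝ (X →L[ℝ] X)} {Ξ : Type*}

/-! ### The algorithm along a path -/

section Invariants

variable {η δ : ℝ} {α : ℕ → ℝ} {G : Ξ → X → X} {ξ ξ' : ℕ → Ξ}

theorem iter_S_mem (hℋ : IsPrecondSpace ℋ) (k : ℕ) : (iter ℋ η δ α G ξ ξ' k).S ∈ ℋ := by
  induction k with
  | zero => exact ℋ.smul_mem _ hℋ.one_mem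
  | succ k ih => exact ℋ.add_mem ih (proj_mem _ _)

theorem iter_S_sub_isPositive (hℋ : IsPrecondSpace ℋ) (k : ℕ) :
    ((iter ℋ η δ α G ξ ξ' k).S - δ ^ 2 • 1).IsPositive := by
  induction k with
  | zero =>
    simp only [iter, sub_self]
    exact ContinuousLinearMap.isPositive_zero
  | succ k ih =>
    simp only [iter, step]
    rw [add_sub_right_comm]
    exact ih.add (hℋ.proj_outer_isPositive _)

theorem isPosDef_of_sub_isPositive (hδ : 0 < δ) {S : X →L[ℝ] X}
    (h : (S - δ ^ 2 • 1).IsPositive) : IsPosDef S := by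
  have := (isPosDef_one.smul (pow_pos hδ 2)).add h
  rwa [add_sub_cancel] at this

theorem isPosDef_iter_S (hℋ : IsPrecondSpace ℋ) (hδ : 0 < δ) (k : ℕ) :
    IsPosDef (iter ℋ η δ α G ξ ξ' k).S :=
  isPosDef_of_sub_isPositive hδ (iter_S_sub_isPositive hℋ k)

theorem iter_x_mem_Q (hℋ : IsPrecondSpace ℋ) (hη : 0 ≤ η) (hδ : 0 < δ) (k : ℕ) :
    (iter ℋ η δ α G ξ ξ' k).x ∈ Q ℋ η := by
  cases k with
  | zero => exact hℋ.zero_mem_Q hη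
  | succ k => exact hℋ.neg_gradient_Psi_mem_Q (iter_S_mem hℋ k) (isPosDef_iter_S hℋ hδ k) hη _

theorem interp_mem_Q (hℋ : IsPrecondSpace ℋ) (hη : 0 ≤ η) {a : ℝ} (ha : 1 ≤ a) {xbar z : X}
    (hxbar : xbar ∈ Q ℋ η) (hz : z ∈ Q ℋ η) : interp a xbar z ∈ Q ℋ η :=
  hℋ.convex_Q hη hz hxbar (inv_nonneg.2 (by linarith)) (sub_nonneg.2 (inv_le_one_of_one_le₀ ha))
    (by ring)

theorem iter_xbar_mem_Q (hℋ : IsPrecondSpace ℋ) (hη : 0 ≤ η) (hδ : 0 < δ) (hα : ∀ k, 1 ≤ α k)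
    (k : ℕ) : (iter ℋ η δ α G ξ ξ' k).xbar ∈ Q ℋ η := by
  induction k with
  | zero => exact hℋ.zero_mem_Q hη
  | succ k ih => exact interp_mem_Q hℋ hη (hα k) ih (iter_x_mem_Q hℋ hη hδ (k + 1))

end Invariants

theorem inner_add_sub_le {A : X →L[ℝ] X} (hA : A.IsPositive) (u v w : X) :
    ⟪u + v - w, A (u + v - w)⟫ ≤ 3 * (⟪u, A u⟫ + ⟪v, A v⟫ + ⟪w, A w⟫) := by
  have h1 := hA.inner_nonneg_right (u - v)
  have h2 := hA.inner_nonneg_right (u + w)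
  have h3 := hA.inner_nonneg_right (v + w)
  simp only [map_add, map_sub, inner_add_left, inner_add_right, inner_sub_left, inner_sub_right]
    at h1 h2 h3 ⊢
  linarith

/-- One iteration of the acceleration scheme, with `y₀`, `y₁` the two query points and `n₀`, `n₁`
the noise of the stochastic gradients at these points. -/
theorem accelerated_step {B : X →L[ℝ] X} {f : X → ℝ} {gradf : X → X} {L ν ρ : ℝ}
    (hconv : ConvexOn ℝ Set.univ f) (hf : IsHolderSmooth f B L ν) (hB : IsPosDef B)
    (hg : ∀ x, IsSubgradient f x (gradf x)) (hL : 0 < L) (hρ : 0 < ρ) (hν : 0 ≤ ν) (hν1 : ν ≤ 1)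
    {a : ℝ} (ha : 1 ≤ a) (xs xbar x x' y₀ y₁ n₀ n₁ : X) (hy₀ : y₀ = interp a xbar x)
    (hy₁ : y₁ = interp a xbar x') :
    a ^ 2 * (f y₁ - f xs) ≤ (a ^ 2 - a) * (f xbar - f xs)
      + ⟪a • (gradf y₀ + n₀), x' - xs⟫
      + ⟪a • (gradf y₁ + n₁) - a • (gradf y₀ + n₀), x' - x⟫
      - a * (⟪n₀, x - xs⟫ + ⟪n₁, x' - x⟫)
      - a ^ 2 * ((4 * (L * ρ ^ (ν - 1)))⁻¹
          * ⟪gradf y₁ - gradf y₀, Ring.inverse B (gradf y₁ - gradf y₀)⟫)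
      + a ^ 2 * (L * ρ ^ (ν - 1) * ρ ^ 2) := by
  have ha0 : 0 < a := by linarith
  have h1 := hf.cocoercive hB hg hL hρ hν hν1 y₁ y₀
  have h2 := hg y₀ (interp a xbar xs)
  have h3 : f (interp a xbar xs) ≤ a⁻¹ * f xs + (1 - a⁻¹) * f xbar :=
    hconv.2 (Set.mem_univ xs) (Set.mem_univ xbar) (inv_nonneg.2 ha0.le)
      (sub_nonneg.2 (inv_le_one_of_one_le₀ ha)) (by ring)
  have e1 : interp a xbar xs - y₀ = -(a⁻¹ • (x - xs)) := by
    rw [hy₀, interp, interp]; module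
  have e2 : y₁ - y₀ = a⁻¹ • (x' - x) := by
    rw [hy₀, hy₁, interp, interp]; module
  rw [e1, inner_neg_right, inner_smul_right] at h2
  rw [e2, inner_smul_right] at h1
  set q := (4 * (L * ρ ^ (ν - 1)))⁻¹
    * ⟪gradf y₁ - gradf y₀, Ring.inverse B (gradf y₁ - gradf y₀)⟫
  set E := L * ρ ^ (ν - 1) * ρ ^ 2
  have h4 : f y₁ ≤ a⁻¹ * f xs + (1 - a⁻¹) * f xbar + a⁻¹ * ⟪gradf y₀, x - xs⟫
      + a⁻¹ * ⟪gradf y₁, x' - x⟫ - q + E := by linarith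
  have h5 := mul_le_mul_of_nonneg_left h4 (sq_nonneg a)
  have h6 : a ^ 2 * (a⁻¹ * f xs + (1 - a⁻¹) * f xbar + a⁻¹ * ⟪gradf y₀, x - xs⟫
      + a⁻¹ * ⟪gradf y₁, x' - x⟫ - q + E) = a * f xs + (a ^ 2 - a) * f xbar
      + a * ⟪gradf y₀, x - xs⟫ + a * ⟪gradf y₁, x' - x⟫ - a ^ 2 * q + a ^ 2 * E := by
    field_simp
  have e3 : x' - xs = (x' - x) + (x - xs) := by abel
  rw [h6] at h5
  rw [e3]
  simp only [inner_sub_left (a • (gradf y₁ + n₁)), inner_add_right, inner_smul_left,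
    inner_add_left, conj_trivial]
  linarith

/-- The pathwise bound: up to the noise terms, which are centred or quadratic, the weighted
optimality gap is bounded by a constant. The quadratic terms in the differences of the subgradients
are absorbed by co-coercivity as soon as `c ≥ 36 R M` for `M = L ρ ^ (ν - 1)`. -/
theorem pathwise_bound (hℋ : IsPrecondSpace ℋ) {B : X →L[ℝ] X} (hBm : B ∈ ℋ) (hB : IsPosDef B)
    (htr : trNorm B = 1) {R δ L ν ρ c : ℝ} (hR : 0 < R) (hδ : 0 < δ) (hL : 0 < L) (hν : 0 ≤ ν)
    (hν1 : ν ≤ 1) (hρ : 0 < ρ) (hc : 36 * R * (L * ρ ^ (ν - 1)) ≤ c)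
    {f : X → ℝ} (hconv : ConvexOn ℝ Set.univ f) (hf : IsHolderSmooth f B L ν) {xs : X}
    (hxs : xs ∈ Q ℋ R) (hmin : IsMinOn f (Q ℋ R) xs) {gradf : X → X}
    (hg : ∀ x, IsSubgradient f x (gradf x)) {α : ℕ → ℝ} (hα0 : α 0 = 1) (hα : ∀ k, 1 ≤ α k)
    (hαs : ∀ k, α (k + 1) ^ 2 - α (k + 1) ≤ α k ^ 2)
    (G : Ξ → X → X) (ξ ξ' : ℕ → Ξ) (s : ℕ → State X)
    (hs : ∀ k, s k = iter ℋ R δ α G ξ ξ' k) (y n₀ n₁ : ℕ → X)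
    (hy : ∀ k, y k = interp (α k) (s k).xbar (s k).x)
    (hn₀ : ∀ k, n₀ k = G (ξ k) (y k) - gradf (y k))
    (hn₁ : ∀ k, n₁ k = G (ξ' k) (s (k + 1)).xbar - gradf (s (k + 1)).xbar) (K : ℕ) :
    α K ^ 2 * (f (s (K + 1)).xbar - f xs) ≤
      R * (6 * (δ * Module.finrank ℝ X) + 3 * c)
      + ∑ k ∈ Finset.range (K + 1), (9 * R * c⁻¹ * α k ^ 2
          * (wnorm (Ring.inverse B) (n₀ k) ^ 2 + wnorm (Ring.inverse B) (n₁ k) ^ 2)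
        - α k * (⟪n₀ k, (s k).x - xs⟫ + ⟪n₁ k, (s (k + 1)).x - (s k).x⟫)
        + α k ^ 2 * (L * ρ ^ (ν - 1) * ρ ^ 2)) := by
  have hM : 0 < L * ρ ^ (ν - 1) := mul_pos hL (Real.rpow_pos_of_pos hρ _)
  have hc0 : 0 < c := lt_of_lt_of_le (by positivity) hc
  set M := L * ρ ^ (ν - 1)
  rw [trNorm_of_isPosDef hB] at htr
  set g : ℕ → X := fun k => α k • (gradf (y k) + n₀ k) with hgdef
  set d : ℕ → X := fun k => α k • (gradf (s (k + 1)).xbar + n₁ k) - g k with hddef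
  have hgk : ∀ k, g k = auxGrad G (α k) (s k).xbar (ξ k) (s k).x := fun k => by
    simp only [hgdef, hn₀, hy, auxGrad, add_sub_cancel]
  have hxb : ∀ k, (s (k + 1)).xbar = interp (α k) (s k).xbar (s (k + 1)).x := fun k => by
    rw [hs (k + 1), hs k]; rfl
  have hdk : ∀ k, d k = auxGrad G (α k) (s k).xbar (ξ' k) (s (k + 1)).x - g k := fun k => by
    simp only [hddef, hn₁, auxGrad, add_sub_cancel, ← hxb]
  have hmk : ∀ k, (s (k + 1)).m = (s k).m + g k := fun k => by
    rw [hgk, hs (k + 1), hs k]; rfl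
  have hxk : ∀ k, (s (k + 1)).x = -∇ (Psi R ℋ (s k).S) (s (k + 1)).m := fun k => by
    rw [hs (k + 1), hs k]; rfl
  have hSk : ∀ k, (s (k + 1)).S = (s k).S + proj ℋ (outer (d k)) := fun k => by
    rw [hdk, hgk, hs (k + 1), hs k]; rfl
  have hS0 : (s 0).S = δ ^ 2 • 1 := by rw [hs]; rfl
  have hxbQ : ∀ k, (s k).xbar ∈ Q ℋ R := fun k => by
    rw [hs]; exact iter_xbar_mem_Q hℋ hR.le hδ hα k
  have hreg := hℋ.sum_regret_le (S := fun k => (s k).S) (m := fun k => (s k).m)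
    (x := fun k => (s k).x) (g := g) (d := d)
    (fun k => by simp only [hs]; exact iter_S_mem hℋ k)
    (fun k => by simp only [hs]; exact isPosDef_iter_S hℋ hδ k) hR (by simp only [hs]; rfl)
    (by simp only [hs]; rfl) hmk hxk hSk hxs K
  have htrS := hℋ.two_tr_opSqrt_sum_le (S := fun k => (s k).S) (d := d) hBm hB htr hδ hc0 hS0 hSk
    (K + 1)
  -- summing the accelerated steps
  have htel : ∀ j, α j ^ 2 * (f (s (j + 1)).xbar - f xs) ≤
      ∑ k ∈ Finset.range (j + 1), (⟪g k, (s (k + 1)).x - xs⟫ + ⟪d k, (s (k + 1)).x - (s k).x⟫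
        - α k * (⟪n₀ k, (s k).x - xs⟫ + ⟪n₁ k, (s (k + 1)).x - (s k).x⟫)
        - α k ^ 2 * ((4 * M)⁻¹ * ⟪gradf (s (k + 1)).xbar - gradf (y k),
            Ring.inverse B (gradf (s (k + 1)).xbar - gradf (y k))⟫)
        + α k ^ 2 * (M * ρ ^ 2)) := fun j => by
    have hstep := fun k => accelerated_step hconv hf hB hg hL hρ hν hν1 (hα k) xs (s k).xbar
      (s k).x (s (k + 1)).x (y k) (s (k + 1)).xbar (n₀ k) (n₁ k) (hy k) (hxb k)
    induction j with
    | zero =>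
      have h := hstep 0
      have e : (α 0 ^ 2 - α 0) * (f (s 0).xbar - f xs) = 0 := by rw [hα0]; ring
      rw [e] at h
      rw [zero_add, Finset.sum_range_one]
      linarith
    | succ j ih =>
      have h := hstep (j + 1)
      have h2 := mul_le_mul_of_nonneg_right (hαs j) (sub_nonneg.2 (hmin (hxbQ (j + 1))))
      rw [Finset.sum_range_succ]
      linarith
  have hq : ∀ k, 3 * R * c⁻¹ * ⟪d k, Ring.inverse B (d k)⟫
      ≤ α k ^ 2 * ((4 * M)⁻¹ * ⟪gradf (s (k + 1)).xbar - gradf (y k),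
            Ring.inverse B (gradf (s (k + 1)).xbar - gradf (y k))⟫)
        + 9 * R * c⁻¹ * α k ^ 2
          * (wnorm (Ring.inverse B) (n₀ k) ^ 2 + wnorm (Ring.inverse B) (n₁ k) ^ 2) := fun k => by
    have hBi := hB.inverse.isPositive
    rw [wnorm_sq hBi, wnorm_sq hBi]
    have e : d k = α k • ((gradf (s (k + 1)).xbar - gradf (y k)) + n₁ k - n₀ k) := by
      simp only [hddef, hgdef]; module
    have h := inner_add_sub_le hBi (gradf (s (k + 1)).xbar - gradf (y k)) (n₁ k) (n₀ k)
    rw [e, map_smul, inner_smul_left, inner_smul_right, conj_trivial]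
    set q := ⟪gradf (s (k + 1)).xbar - gradf (y k),
            Ring.inverse B (gradf (s (k + 1)).xbar - gradf (y k))⟫
    have hq0 : 0 ≤ q := hBi.inner_nonneg_right _
    have hcM : 9 * R * c⁻¹ ≤ (4 * M)⁻¹ := by
      rw [← div_eq_mul_inv, div_le_iff₀ hc0, inv_mul_eq_div, le_div_iff₀ (by positivity)]
      linarith
    have h1 := mul_le_mul_of_nonneg_left h (show 0 ≤ 3 * R * c⁻¹ * α k ^ 2 by positivity)
    have h2 := mul_le_mul_of_nonneg_left (mul_le_mul_of_nonneg_right hcM hq0) (sq_nonneg (α k))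
    linarith
  have hq' := Finset.sum_le_sum fun k (_ : k ∈ Finset.range (K + 1)) => hq k
  have h1 := htel K
  have h2 := mul_le_mul_of_nonneg_left htrS (show 0 ≤ 3 * R by positivity)
  simp only [Finset.sum_add_distrib, Finset.sum_sub_distrib, ← Finset.mul_sum] at h1 hq' hreg h2 ⊢
  linarith

end Pathwise

section Measurability

variable {X : Type*} [NormedAddCommGroup X] [InnerProductSpace ℝ X] [FiniteDimensional ℝ X]
variable {ℋ : Submodule ℝ (X →L[ℝ] X)}

/-! ### Measurability of the iterates -/

theorem smul_one_sub_isPositive {A : X →L[ℝ] X} (hA : IsSelfAdjoint A) {c : ℝ}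
    (hc : ‖A‖ ≤ c) : (c • 1 - A).IsPositive := by
  refine isPositive_iff_inner.2
    ⟨((IsSelfAdjoint.all c).smul (IsSelfAdjoint.one (X →L[ℝ] X))).sub hA, fun x => ?_⟩
  have h : ⟪x, A x⟫ ≤ c * ‖x‖ ^ 2 :=
    calc ⟪x, A x⟫ ≤ ‖x‖ * ‖A x‖ := real_inner_le_norm _ _
      _ ≤ ‖x‖ * (c * ‖x‖) := by gcongr; exact A.le_of_opNorm_le hc x
      _ = c * ‖x‖ ^ 2 := by ring
  simp only [_root_.sub_apply, _root_.smul_apply, one_apply_eq_self, inner_sub_right,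
    inner_smul_right, real_inner_self_eq_norm_sq]
  linarith

/-- `√A ≤ √B + ε` when `A ≤ B + ε²`. -/
theorem opSqrt_add_smul_sub_isPositive {A B : X →L[ℝ] X} (hA : A.IsPositive) (hB : B.IsPositive)
    {ε : ℝ} (hε : 0 < ε) (h : (ε ^ 2 • 1 - (A - B)).IsPositive) :
    (opSqrt B + ε • 1 - opSqrt A).IsPositive := by
  have hp : IsPosDef (opSqrt B + ε • 1) := by
    rw [add_comm]
    exact (isPosDef_one.smul hε).add (opSqrt_isPositive B)
  refine isPositive_sub_of_sq (opSqrt_isPositive A) hp ?_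
  have e : (opSqrt B + ε • 1) * (opSqrt B + ε • 1) - opSqrt A * opSqrt A
      = (ε ^ 2 • 1 - (A - B)) + (2 * ε) • opSqrt B := by
    rw [opSqrt_mul_self hA]
    simp only [mul_add, add_mul, opSqrt_mul_self hB, smul_mul_assoc, mul_smul_comm, mul_one,
      one_mul]
    module
  rw [e]
  exact h.add ((opSqrt_isPositive B).smul_of_nonneg (by positivity))

/-- The square root is `1/2`-Hölder continuous. -/
theorem norm_opSqrt_sub_le {A B : X →L[ℝ] X} (hA : A.IsPositive) (hB : B.IsPositive) :
    ‖opSqrt A - opSqrt B‖ ≤ 3 * √‖A - B‖ := by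
  rcases eq_or_ne A B with rfl | hne
  · simp
  have hε : 0 < √‖A - B‖ := Real.sqrt_pos.2 (norm_pos_iff.2 (sub_ne_zero.2 hne))
  have hsq : √‖A - B‖ ^ 2 = ‖A - B‖ := Real.sq_sqrt (norm_nonneg _)
  set ε := √‖A - B‖
  have h1 := opSqrt_add_smul_sub_isPositive hA hB hε
    (smul_one_sub_isPositive (hA.isSelfAdjoint.sub hB.isSelfAdjoint) hsq.ge)
  have h2 := opSqrt_add_smul_sub_isPositive hB hA hε
    (smul_one_sub_isPositive (hB.isSelfAdjoint.sub hA.isSelfAdjoint)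
      (by rw [norm_sub_rev]; exact hsq.ge))
  have h3 : ‖opSqrt B + ε • 1 - opSqrt A‖ ≤ 2 * ε := by
    refine norm_le_of_isPositive h1 (by positivity) ?_
    convert h2 using 1
    module
  have h4 : ‖ε • (1 : X →L[ℝ] X)‖ ≤ ε := by
    rw [norm_smul, Real.norm_of_nonneg hε.le]
    exact mul_le_of_le_one_right hε.le ContinuousLinearMap.norm_id_le
  calc ‖opSqrt A - opSqrt B‖ = ‖ε • (1 : X →L[ℝ] X) - (opSqrt B + ε • 1 - opSqrt A)‖ := by
        congr 1; abel
    _ ≤ ‖ε • (1 : X →L[ℝ] X)‖ + ‖opSqrt B + ε • 1 - opSqrt A‖ := norm_sub_le _ _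
    _ ≤ 3 * ε := by linarith

theorem continuousOn_opSqrt : ContinuousOn (opSqrt (X := X)) {A | A.IsPositive} := by
  intro A hA
  rw [ContinuousWithinAt, tendsto_iff_norm_sub_tendsto_zero]
  have h : Filter.Tendsto (fun T : X →L[ℝ] X => 3 * √‖T - A‖)
      (nhdsWithin A {A | A.IsPositive}) (nhds 0) := by
    have hc : Continuous fun T : X →L[ℝ] X => 3 * √‖T - A‖ := by fun_prop
    have := hc.tendsto A
    simp only [sub_self, norm_zero, Real.sqrt_zero, mul_zero] at this
    exact this.mono_left nhdsWithin_le_nhds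
  refine squeeze_zero' (.of_forall fun T => norm_nonneg _) ?_ h
  filter_upwards [self_mem_nhdsWithin] with T hT
  exact norm_opSqrt_sub_le hT hA

theorem isClosed_isPositive : IsClosed {A : X →L[ℝ] X | A.IsPositive} := by
  have h : {A : X →L[ℝ] X | A.IsPositive}
      = {A | star A = A} ∩ ⋂ x : X, {A | 0 ≤ ⟪x, A x⟫} := by
    ext A
    simp only [Set.mem_ofPred_eq, Set.mem_inter_iff, Set.mem_iInter]
    exact isPositive_iff_inner
  rw [h]
  refine (isClosed_eq continuous_star continuous_id).inter (isClosed_iInter fun x => ?_)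
  exact isClosed_le continuous_const
    (continuous_const.inner (ContinuousLinearMap.apply ℝ X x).continuous)

theorem continuous_outer : Continuous (outer : X → X →L[ℝ] X) := by
  exact (rankOne ℝ).continuous.clm_apply continuous_id

theorem continuous_proj (ℋ : Submodule ℝ (X →L[ℝ] X)) : Continuous (proj ℋ) :=
  LinearMap.continuous_of_finiteDimensional _

/-- The gradient of the regularizer, jointly in `S` and `m`, is continuous on `S ≥ δ²`. -/
theorem continuousOn_inverse_prec (hℋ : IsPrecondSpace ℋ) {δ : ℝ} (hδ : 0 < δ) :
    ContinuousOn (fun q : (X →L[ℝ] X) × X => Ring.inverse (prec ℋ q.1 q.2) q.2)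
      {q | (q.1 - δ ^ 2 • 1).IsPositive} := by
  have hpos : ∀ q ∈ {q : (X →L[ℝ] X) × X | (q.1 - δ ^ 2 • 1).IsPositive}, IsPosDef q.1 :=
    fun q hq => isPosDef_of_sub_isPositive hδ hq
  have h1 : ContinuousOn (fun q : (X →L[ℝ] X) × X => prec ℋ q.1 q.2)
      {q | (q.1 - δ ^ 2 • 1).IsPositive} := by
    refine continuousOn_opSqrt.comp (f := fun q : (X →L[ℝ] X) × X => proj ℋ (outer q.2) + q.1)
      ?_ fun q hq => (hℋ.isPosDef_proj_add (hpos q hq) q.2).isPositive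
    exact ((((continuous_proj ℋ).comp continuous_outer).comp continuous_snd).add
      continuous_fst).continuousOn
  refine ContinuousOn.clm_apply (fun q hq => ?_) continuous_snd.continuousOn
  obtain ⟨u, hu⟩ := (hℋ.isPosDef_prec (hpos q hq) q.2).isUnit
  have h2 := NormedRing.inverse_continuousAt u
  rw [hu] at h2
  exact ContinuousAt.comp_continuousWithinAt (f := fun q : (X →L[ℝ] X) × X => prec ℋ q.1 q.2) h2
    (h1 q hq)

theorem iter_congr {Ξ : Type*} {η δ : ℝ} {α : ℕ → ℝ} {G : Ξ → X → X} {ξ ξ' ζ ζ' : ℕ → Ξ} {k : ℕ}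
    (h : ∀ j < k, ξ j = ζ j) (h' : ∀ j < k, ξ' j = ζ' j) :
    iter ℋ η δ α G ξ ξ' k = iter ℋ η δ α G ζ ζ' k := by
  induction k with
  | zero => rfl
  | succ k ih =>
    rw [iter, iter, ih (fun j hj => h j (by omega)) (fun j hj => h' j (by omega)),
      h k (by omega), h' k (by omega)]

/-- The points computed in iteration `k` do not depend on the second sample of that iteration. -/
theorem iter_succ_congr {Ξ : Type*} {η δ : ℝ} {α : ℕ → ℝ} {G : Ξ → X → X}
    {ξ ξ' ζ ζ' : ℕ → Ξ} {k : ℕ}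
    (h : ∀ j < k + 1, ξ j = ζ j) (h' : ∀ j < k, ξ' j = ζ' j) :
    (iter ℋ η δ α G ξ ξ' (k + 1)).x = (iter ℋ η δ α G ζ ζ' (k + 1)).x ∧
    (iter ℋ η δ α G ξ ξ' (k + 1)).xbar = (iter ℋ η δ α G ζ ζ' (k + 1)).xbar := by
  simp only [iter, step, iter_congr (ℋ := ℋ) (η := η) (δ := δ) (α := α) (G := G) (k := k)
    (fun j hj => h j (by omega)) h', h k (by omega), and_self]

variable [MeasurableSpace X] [BorelSpace X] {Ξ : Type*} [MeasurableSpace Ξ]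

theorem measurable_neg_gradient_Psi (hℋ : IsPrecondSpace ℋ) {η δ : ℝ} (hη : 0 ≤ η) (hδ : 0 < δ)
    {β : Type*} [MeasurableSpace β] {S : β → X →L[ℝ] X} {m : β → X} (hS : Measurable S)
    (hm : Measurable m) (hmem : ∀ w, S w ∈ ℋ) (hpos : ∀ w, (S w - δ ^ 2 • 1).IsPositive) :
    Measurable fun w => -∇ (Psi η ℋ (S w)) (m w) := by
  classical
  have hcl : IsClosed {q : (X →L[ℝ] X) × X | (q.1 - δ ^ 2 • 1).IsPositive} :=
    isClosed_isPositive.preimage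
      (continuous_fst.sub continuous_const : Continuous fun q : (X →L[ℝ] X) × X =>
        q.1 - δ ^ 2 • 1)
  have h := (continuousOn_inverse_prec hℋ hδ).measurable_piecewise
    (g := fun _ => (0 : X)) continuousOn_const hcl.measurableSet
  have h2 := (h.comp (hS.prodMk hm)).const_smul (-η)
  convert h2 using 2 with w
  rw [hℋ.gradient_Psi (hmem w) (isPosDef_of_sub_isPositive hδ (hpos w)) hη, Pi.smul_apply,
    Function.comp_apply, neg_smul]
  congr 2
  have hw : (S w, m w) ∈ {q : (X →L[ℝ] X) × X | (q.1 - δ ^ 2 • 1).IsPositive} := hpos w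
  exact (Set.piecewise_eq_of_mem _ (fun q : (X →L[ℝ] X) × X => Ring.inverse (prec ℋ q.1 q.2) q.2)
    (fun _ => (0 : X)) hw).symm

theorem measurable_interp {β : Type*} [MeasurableSpace β] (a : ℝ) {u v : β → X}
    (hu : Measurable u) (hv : Measurable v) : Measurable fun w => interp a (u w) (v w) := by
  unfold interp
  exact (hv.const_smul _).add (hu.const_smul _)

theorem measurable_iter (hℋ : IsPrecondSpace ℋ) {η δ : ℝ} (hη : 0 ≤ η) (hδ : 0 < δ) {α : ℕ → ℝ}
    {G : Ξ → X → X} (hG : Measurable (Function.uncurry G)) (k : ℕ) :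
    Measurable (fun w : (ℕ → Ξ) × (ℕ → Ξ) => (iter ℋ η δ α G w.1 w.2 k).x) ∧
    Measurable (fun w : (ℕ → Ξ) × (ℕ → Ξ) => (iter ℋ η δ α G w.1 w.2 k).xbar) ∧
    Measurable (fun w : (ℕ → Ξ) × (ℕ → Ξ) => (iter ℋ η δ α G w.1 w.2 k).m) ∧
    Measurable (fun w : (ℕ → Ξ) × (ℕ → Ξ) => (iter ℋ η δ α G w.1 w.2 k).S) := by
  induction k with
  | zero => exact ⟨measurable_const, measurable_const, measurable_const, measurable_const⟩
  | succ k ih =>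
    obtain ⟨hx, hxb, hm, hS⟩ := ih
    have hξ : Measurable fun w : (ℕ → Ξ) × (ℕ → Ξ) => w.1 k :=
      (measurable_pi_apply k).comp measurable_fst
    have hξ' : Measurable fun w : (ℕ → Ξ) × (ℕ → Ξ) => w.2 k :=
      (measurable_pi_apply k).comp measurable_snd
    have hg : Measurable fun w : (ℕ → Ξ) × (ℕ → Ξ) => auxGrad G (α k)
        (iter ℋ η δ α G w.1 w.2 k).xbar (w.1 k) (iter ℋ η δ α G w.1 w.2 k).x :=
      (hG.comp (hξ.prodMk (measurable_interp (α k) hxb hx))).const_smul (α k)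
    have hm' : Measurable fun w : (ℕ → Ξ) × (ℕ → Ξ) => (iter ℋ η δ α G w.1 w.2 (k + 1)).m :=
      hm.add hg
    have hx' : Measurable fun w : (ℕ → Ξ) × (ℕ → Ξ) => (iter ℋ η δ α G w.1 w.2 (k + 1)).x :=
      measurable_neg_gradient_Psi hℋ hη hδ hS hm' (fun w => iter_S_mem hℋ k)
        fun w => iter_S_sub_isPositive hℋ k
    have hg' : Measurable fun w : (ℕ → Ξ) × (ℕ → Ξ) => auxGrad G (α k)
        (iter ℋ η δ α G w.1 w.2 k).xbar (w.2 k) (iter ℋ η δ α G w.1 w.2 (k + 1)).x :=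
      (hG.comp (hξ'.prodMk (measurable_interp (α k) hxb hx'))).const_smul (α k)
    refine ⟨hx', measurable_interp (α k) hxb hx', hm', ?_⟩
    exact hS.add ((((continuous_proj ℋ).comp continuous_outer).measurable).comp (hg'.sub hg))

end Measurability

section Noise

variable {X : Type*} [NormedAddCommGroup X] [InnerProductSpace ℝ X] [FiniteDimensional ℝ X]
variable [MeasurableSpace X] [BorelSpace X] {Ξ : Type*} [MeasurableSpace Ξ]
variable {Ω : Type*} [MeasurableSpace Ω] {P : Measure Ω} [IsProbabilityMeasure P]

/-! ### Noise terms of the stochastic gradients -/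

/-- A function of those samples whose index lies in `T` is independent of any other sample. -/
theorem indepFun_of_finset {ξ ξ' : ℕ → Ω → Ξ} (hξ : ∀ k, AEMeasurable (ξ k) P)
    (hξ' : ∀ k, AEMeasurable (ξ' k) P) (hind : iIndepFun (Sum.elim ξ ξ') P)
    {β : Type*} [MeasurableSpace β] {Φ : (ℕ → Ξ) × (ℕ → Ξ) → β} (hΦ : Measurable Φ)
    (T : Finset (ℕ ⊕ ℕ)) (hT : ∀ w w' : (ℕ → Ξ) × (ℕ → Ξ),
      (∀ i ∈ T, Sum.elim w.1 w.2 i = Sum.elim w'.1 w'.2 i) → Φ w = Φ w')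
    {i₀ : ℕ ⊕ ℕ} (hi₀ : i₀ ∉ T) :
    IndepFun (fun ω => Φ (fun j => ξ j ω, fun j => ξ' j ω)) (Sum.elim ξ ξ' i₀) P := by
  classical
  have hmeas : ∀ i, AEMeasurable (Sum.elim ξ ξ' i) P := by
    rintro (i | i)
    · exact hξ i
    · exact hξ' i
  have hne : Nonempty Ξ := (nonempty_of_isProbabilityMeasure P).map (ξ 0)
  obtain ⟨e⟩ := hne
  have h := hind.indepFun_finset₀ T {i₀} (by simpa using hi₀) hmeas
  -- `Φ` factors through the finitely many samples in `T`
  let ext : (T → Ξ) → ℕ ⊕ ℕ → Ξ := fun v i => if h : i ∈ T then v ⟨i, h⟩ else e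
  have hext : ∀ i, Measurable fun v => ext v i := fun i => by
    by_cases hi : i ∈ T
    · simpa only [ext, hi, dite_true] using measurable_pi_apply _
    · simpa only [ext, hi, dite_false] using measurable_const
  have hφ : Measurable fun v : T → Ξ => Φ (fun j => ext v (.inl j), fun j => ext v (.inr j)) :=
    hΦ.comp ((measurable_pi_lambda _ fun j => hext _).prodMk
      (measurable_pi_lambda _ fun j => hext _))
  have hψ : Measurable fun v : ({i₀} : Finset (ℕ ⊕ ℕ)) → Ξ =>
      v ⟨i₀, Finset.mem_singleton_self i₀⟩ := measurable_pi_apply _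
  have h2 := h.comp hφ hψ
  have e1 : (fun ω => Φ (fun j => ξ j ω, fun j => ξ' j ω))
      = (fun v : T → Ξ => Φ (fun j => ext v (.inl j), fun j => ext v (.inr j)))
        ∘ fun ω i => Sum.elim ξ ξ' i ω := by
    funext ω
    refine hT _ _ fun i hi => ?_
    rcases i with i | i <;> simp [ext, hi]
  rw [e1]
  exact h2

theorem IsStochGrad.integrable_sample {f : X → ℝ} {B : X →L[ℝ] X} {σ : ℝ} {D : Measure Ξ}
    [IsProbabilityMeasure D] {gradf : X → X} {G : Ξ → X → X} (h : IsStochGrad f B σ D gradf G)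
    (x : X) : Integrable (fun ξ => G ξ x) D := by
  exact ((h.integrable x).add (integrable_const (gradf x))).congr (.of_forall fun ξ => by simp)

theorem IsStochGrad.measurable_grad {f : X → ℝ} {B : X →L[ℝ] X} {σ : ℝ} {D : Measure Ξ}
    [IsProbabilityMeasure D] {gradf : X → X} {G : Ξ → X → X} (h : IsStochGrad f B σ D gradf G) :
    Measurable gradf := by
  have e : gradf = fun x => ∫ ξ, G ξ x ∂D := by
    funext x
    have h0 := h.mean_zero x
    rw [integral_sub (h.integrable_sample x) (integrable_const _)] at h0
    simpa using (sub_eq_zero.1 h0).symm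
  have hs : StronglyMeasurable (Function.uncurry fun (x : X) (ξ : Ξ) => G ξ x) :=
    (h.measurable.comp measurable_swap).stronglyMeasurable
  rw [e]
  exact hs.integral_prod_right.measurable

theorem continuous_inner_apply (A : X →L[ℝ] X) : Continuous fun x : X => ⟪x, A x⟫ :=
  continuous_id.inner A.continuous

/-- The noise at a random query point `U.1` that is independent of the sample `ζ` has variance at
most `σ²`, and is centred even when tested against a random vector `U.2` independent of `ζ`. -/
theorem IsStochGrad.noise {f : X → ℝ} {B : X →L[ℝ] X} (hB : IsPosDef B) {σ : ℝ} {D : Measure Ξ}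
    [IsProbabilityMeasure D] {gradf : X → X} {G : Ξ → X → X} (h : IsStochGrad f B σ D gradf G)
    {ζ : Ω → Ξ} (hζ : HasLaw ζ D P) {U : Ω → X × X} (hU : AEMeasurable U P)
    (hind : IndepFun U ζ P) {C : ℝ} (hC : ∀ ω, ⟪(U ω).2, B (U ω).2⟫ ≤ C) :
    Integrable (fun ω => wnorm (Ring.inverse B) (G (ζ ω) (U ω).1 - gradf (U ω).1) ^ 2) P ∧
    ∫ ω, wnorm (Ring.inverse B) (G (ζ ω) (U ω).1 - gradf (U ω).1) ^ 2 ∂P ≤ σ ^ 2 ∧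
    Integrable (fun ω => ⟪G (ζ ω) (U ω).1 - gradf (U ω).1, (U ω).2⟫) P ∧
    ∫ ω, ⟪G (ζ ω) (U ω).1 - gradf (U ω).1, (U ω).2⟫ ∂P = 0 := by
  have hBi := hB.inverse.isPositive
  have hlaw : Measure.map (fun ω => (U ω, ζ ω)) P = (Measure.map U P).prod D := by
    rw [(indepFun_iff_map_prod_eq_prod_map_map hU hζ.aemeasurable).1 hind, hζ.map_eq]
  have hpair : AEMeasurable (fun ω => (U ω, ζ ω)) P := hU.prodMk hζ.aemeasurable
  have : IsProbabilityMeasure (Measure.map U P) := Measure.isProbabilityMeasure_map hU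
  have hn : Measurable fun q : (X × X) × Ξ => G q.2 q.1.1 - gradf q.1.1 :=
    (h.measurable.comp (measurable_snd.prodMk (measurable_fst.comp measurable_fst))).sub
      (h.measurable_grad.comp (measurable_fst.comp measurable_fst))
  have hφ : Measurable fun q : (X × X) × Ξ =>
      wnorm (Ring.inverse B) (G q.2 q.1.1 - gradf q.1.1) ^ 2 := by
    simp only [wnorm_sq hBi]
    exact (continuous_inner_apply (Ring.inverse B)).measurable.comp hn
  have hψ : Measurable fun q : (X × X) × Ξ => ⟪G q.2 q.1.1 - gradf q.1.1, q.1.2⟫ :=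
    hn.inner (measurable_snd.comp measurable_fst)
  have hint : Integrable (fun q : (X × X) × Ξ =>
      wnorm (Ring.inverse B) (G q.2 q.1.1 - gradf q.1.1) ^ 2) ((Measure.map U P).prod D) := by
    rw [integrable_prod_iff hφ.aestronglyMeasurable]
    refine ⟨.of_forall fun u => h.integrable_sq u.1, ?_⟩
    refine (integrable_const (σ ^ 2)).mono'
      hφ.norm.stronglyMeasurable.integral_prod_right'.aestronglyMeasurable
      (.of_forall fun u => ?_)
    simp only [norm_pow, Real.norm_of_nonneg (wnorm_nonneg _ _)]
    rw [Real.norm_of_nonneg (integral_nonneg fun _ => sq_nonneg _)]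
    exact h.variance_le u.1
  have i1 : Integrable (fun ω =>
      wnorm (Ring.inverse B) (G (ζ ω) (U ω).1 - gradf (U ω).1) ^ 2) P := by
    rw [← hlaw, integrable_map_measure hφ.aestronglyMeasurable hpair] at hint
    exact hint
  have i2 : Integrable (fun ω => ⟪G (ζ ω) (U ω).1 - gradf (U ω).1, (U ω).2⟫) P := by
    refine (i1.add (integrable_const C)).mono'
      (hψ.comp_aemeasurable hpair).aestronglyMeasurable (.of_forall fun ω => ?_)
    have h1 := inner_le_wnorm_mul hB (G (ζ ω) (U ω).1 - gradf (U ω).1) (U ω).2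
    have h2 := inner_le_wnorm_mul hB (G (ζ ω) (U ω).1 - gradf (U ω).1) (-(U ω).2)
    have h3 := hC ω
    have e : wnorm B (-(U ω).2) = wnorm B (U ω).2 := by
      simp [wnorm]
    rw [← wnorm_sq hB.isPositive] at h3
    rw [e, inner_neg_right] at h2
    simp only [Pi.add_apply, Real.norm_eq_abs]
    set n := wnorm (Ring.inverse B) (G (ζ ω) (U ω).1 - gradf (U ω).1)
    rw [abs_le]
    constructor <;> nlinarith [sq_nonneg (n - wnorm B (U ω).2), sq_nonneg (n + wnorm B (U ω).2)]
  refine ⟨i1, ?_, i2, ?_⟩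
  · have e := integral_map hpair (hφ.aestronglyMeasurable (μ := Measure.map _ P))
    rw [hlaw, integral_prod _ hint] at e
    rw [← e]
    calc _ ≤ ∫ _u : X × X, σ ^ 2 ∂(Measure.map U P) := by
          refine integral_mono hint.integral_prod_left (integrable_const _) fun u => ?_
          exact h.variance_le u.1
      _ = σ ^ 2 := by simp
  · have e := integral_map hpair (hψ.aestronglyMeasurable (μ := Measure.map _ P))
    have hint2 : Integrable (fun q : (X × X) × Ξ => ⟪G q.2 q.1.1 - gradf q.1.1, q.1.2⟫)
        ((Measure.map U P).prod D) := by
      rw [← hlaw, integrable_map_measure hψ.aestronglyMeasurable hpair]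
      exact i2
    rw [hlaw, integral_prod _ hint2] at e
    rw [← e]
    refine integral_eq_zero_of_ae (.of_forall fun u => ?_)
    have h0 := integral_inner (𝕜 := ℝ) (h.integrable u.1) u.2
    rw [h.mean_zero, inner_zero_right] at h0
    simpa only [real_inner_comm u.2, Pi.zero_apply] using h0

end Noise

section Expectation

variable {X : Type*} [NormedAddCommGroup X] [InnerProductSpace ℝ X] [FiniteDimensional ℝ X]
variable [MeasurableSpace X] [BorelSpace X] {Ξ : Type*} [MeasurableSpace Ξ]
variable {Ω : Type*} [MeasurableSpace Ω] {P : Measure Ω} [IsProbabilityMeasure P]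
variable {ℋ : Submodule ℝ (X →L[ℝ] X)}

/-! ### The bound in expectation -/

theorem inner_sub_le_of_mem_Q (hℋ : IsPrecondSpace ℋ) {B : X →L[ℝ] X} (hBm : B ∈ ℋ)
    (hB : IsPosDef B) (htr : tr B = 1) {R : ℝ} (hR : 0 ≤ R) {x y : X} (hx : x ∈ Q ℋ R)
    (hy : y ∈ Q ℋ R) : ⟪x - y, B (x - y)⟫ ≤ 4 * R ^ 2 := by
  have h1 := hℋ.inner_le_of_mem_Q hR hx hBm hB.isPositive
  have h2 := hℋ.inner_le_of_mem_Q hR hy hBm hB.isPositive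
  have h3 := hB.isPositive.inner_nonneg_right (x + y)
  rw [htr] at h1 h2
  simp only [map_add, map_sub, inner_add_left, inner_add_right, inner_sub_left, inner_sub_right]
    at h3 ⊢
  linarith

/-- Integration of a pathwise bound whose error terms are quadratic noise terms `N₀`, `N₁` of mean
at most `σ²` and centred noise terms `I₀`, `I₁`. -/
theorem integral_le_of_pathwise {F : Ω → ℝ} {N₀ N₁ I₀ I₁ : ℕ → Ω → ℝ} {a : ℕ → ℝ}
    {b c e σ : ℝ} {K : ℕ} (ha : 1 ≤ a K) (hF : AEMeasurable F P) (hF0 : ∀ ω, 0 ≤ F ω) (hb : 0 ≤ b)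
    (H₀ : ∀ k, Integrable (N₀ k) P ∧ ∫ ω, N₀ k ω ∂P ≤ σ ^ 2 ∧ Integrable (I₀ k) P ∧
      ∫ ω, I₀ k ω ∂P = 0)
    (H₁ : ∀ k, Integrable (N₁ k) P ∧ ∫ ω, N₁ k ω ∂P ≤ σ ^ 2 ∧ Integrable (I₁ k) P ∧
      ∫ ω, I₁ k ω ∂P = 0)
    (h : ∀ ω, a K ^ 2 * F ω ≤ c + ∑ k ∈ Finset.range (K + 1),
      (b * a k ^ 2 * (N₀ k ω + N₁ k ω) - a k * (I₀ k ω + I₁ k ω) + a k ^ 2 * e)) :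
    Integrable F P ∧
    a K ^ 2 * ∫ ω, F ω ∂P ≤ c + (2 * b * σ ^ 2 + e) * ∑ k ∈ Finset.range (K + 1), a k ^ 2 := by
  have hT1 : ∀ k, Integrable (fun ω => b * a k ^ 2 * (N₀ k ω + N₁ k ω)) P := fun k =>
    ((H₀ k).1.add (H₁ k).1).const_mul _
  have hT2 : ∀ k, Integrable (fun ω => a k * (I₀ k ω + I₁ k ω)) P := fun k =>
    ((H₀ k).2.2.1.add (H₁ k).2.2.1).const_mul _
  have hT12 : ∀ k, Integrable (fun ω => b * a k ^ 2 * (N₀ k ω + N₁ k ω)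
      - a k * (I₀ k ω + I₁ k ω)) P := fun k => (hT1 k).sub (hT2 k)
  have hTi : ∀ k, Integrable (fun ω => b * a k ^ 2 * (N₀ k ω + N₁ k ω)
      - a k * (I₀ k ω + I₁ k ω) + a k ^ 2 * e) P := fun k => (hT12 k).add (integrable_const _)
  have hTint : ∀ k, ∫ ω, (b * a k ^ 2 * (N₀ k ω + N₁ k ω)
      - a k * (I₀ k ω + I₁ k ω) + a k ^ 2 * e) ∂P ≤ (2 * b * σ ^ 2 + e) * a k ^ 2 := fun k => by
    rw [integral_add (hT12 k) (integrable_const _), integral_sub (hT1 k) (hT2 k),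
      integral_const_mul, integral_const_mul, integral_add (H₀ k).1 (H₁ k).1,
      integral_add (H₀ k).2.2.1 (H₁ k).2.2.1, (H₀ k).2.2.2, (H₁ k).2.2.2]
    have h1 := mul_le_mul_of_nonneg_left (add_le_add (H₀ k).2.1 (H₁ k).2.1)
      (show 0 ≤ b * a k ^ 2 by positivity)
    simp only [integral_const, probReal_univ, one_smul]
    linarith
  have hsumi := integrable_finsetSum (Finset.range (K + 1)) fun k _ => hTi k
  have hsum := (integrable_const (μ := P) c).add hsumi
  have hInt : Integrable F P := by
    refine hsum.mono' hF.aestronglyMeasurable (.of_forall fun ω => ?_)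
    rw [Real.norm_of_nonneg (hF0 ω)]
    exact (le_mul_of_one_le_left (hF0 ω) (one_le_pow₀ ha)).trans (h ω)
  refine ⟨hInt, ?_⟩
  rw [← integral_const_mul]
  refine (integral_mono (hInt.const_mul _) hsum h).trans ?_
  rw [integral_add' (integrable_const c) hsumi, integral_finsetSum _ fun k _ => hTi k,
    Finset.mul_sum]
  simp only [integral_const, probReal_univ, one_smul]
  gcongr with k _
  exact hTint k

/-- The bound in expectation for a general admissible sequence of weights, with the free
parameters `ρ` (inexactness of the smoothness) and `c` (scale of the preconditioner). -/
theorem expectation_bound (hℋ : IsPrecondSpace ℋ) {B : X →L[ℝ] X} (hBm : B ∈ ℋ) (hB : IsPosDef B)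
    (htr : trNorm B = 1) {R δ L ν σ ρ c : ℝ} (hR : 0 < R) (hδ : 0 < δ) (hL : 0 < L) (hν : 0 ≤ ν)
    (hν1 : ν ≤ 1) (hρ : 0 < ρ) (hc : 36 * R * (L * ρ ^ (ν - 1)) ≤ c)
    {f : X → ℝ} (hconv : ConvexOn ℝ Set.univ f) (hf : IsHolderSmooth f B L ν) {xs : X}
    (hxs : xs ∈ Q ℋ R) (hmin : IsMinOn f (Q ℋ R) xs) {D : Measure Ξ} [IsProbabilityMeasure D]
    {gradf : X → X} {G : Ξ → X → X} (hG : IsStochGrad f B σ D gradf G)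
    {ξ ξ' : ℕ → Ω → Ξ} (hξ : ∀ k, HasLaw (ξ k) D P) (hξ' : ∀ k, HasLaw (ξ' k) D P)
    (hind : iIndepFun (Sum.elim ξ ξ') P) {α : ℕ → ℝ} (hα0 : α 0 = 1) (hα : ∀ k, 1 ≤ α k)
    (hαs : ∀ k, α (k + 1) ^ 2 - α (k + 1) ≤ α k ^ 2) {xbar : ℕ → Ω → X}
    (hxbar : ∀ k ω, xbar k ω = (iter ℋ R δ α G (fun j => ξ j ω) (fun j => ξ' j ω) k).xbar)
    (K : ℕ) :
    Integrable (fun ω => f (xbar (K + 1) ω) - f xs) P ∧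
    α K ^ 2 * ∫ ω, (f (xbar (K + 1) ω) - f xs) ∂P ≤
      R * (6 * (δ * Module.finrank ℝ X) + 3 * c)
      + (18 * R * c⁻¹ * σ ^ 2 + L * ρ ^ (ν - 1) * ρ ^ 2)
        * ∑ k ∈ Finset.range (K + 1), α k ^ 2 := by
  have hM : 0 < L * ρ ^ (ν - 1) := mul_pos hL (Real.rpow_pos_of_pos hρ _)
  have hc0 : 0 < c := lt_of_lt_of_le (by positivity) hc
  have htr' := htr
  rw [trNorm_of_isPosDef hB] at htr'
  set s : Ω → ℕ → State X := fun ω k => iter ℋ R δ α G (fun j => ξ j ω) (fun j => ξ' j ω) k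
    with hs
  set y : Ω → ℕ → X := fun ω k => interp (α k) (s ω k).xbar (s ω k).x with hy
  set n₀ : Ω → ℕ → X := fun ω k => G (ξ k ω) (y ω k) - gradf (y ω k) with hn₀
  set n₁ : Ω → ℕ → X := fun ω k =>
    G (ξ' k ω) (s ω (k + 1)).xbar - gradf (s ω (k + 1)).xbar with hn₁
  have hsx : ∀ ω k, (s ω k).x ∈ Q ℋ R := fun ω k => iter_x_mem_Q hℋ hR.le hδ k
  have hsxb : ∀ ω k, (s ω k).xbar ∈ Q ℋ R := fun ω k => iter_xbar_mem_Q hℋ hR.le hδ hα k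
  have hsamples : AEMeasurable (fun ω => ((fun j => ξ j ω, fun j => ξ' j ω) :
      (ℕ → Ξ) × (ℕ → Ξ))) P :=
    (aemeasurable_pi_lambda _ fun k => (hξ k).aemeasurable).prodMk
      (aemeasurable_pi_lambda _ fun k => (hξ' k).aemeasurable)
  have hmeas := fun k => measurable_iter (η := R) (α := α) hℋ hR.le hδ hG.measurable k
  have hnoise₀ := fun k => by
    have hΦ : Measurable fun w : (ℕ → Ξ) × (ℕ → Ξ) =>
        (interp (α k) (iter ℋ R δ α G w.1 w.2 k).xbar (iter ℋ R δ α G w.1 w.2 k).x,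
          (iter ℋ R δ α G w.1 w.2 k).x - xs) :=
      (measurable_interp (α k) (hmeas k).2.1 (hmeas k).1).prodMk ((hmeas k).1.sub_const xs)
    have hi := indepFun_of_finset (fun k => (hξ k).aemeasurable) (fun k => (hξ' k).aemeasurable)
      hind hΦ ((Finset.range k).disjSum (Finset.range k)) (fun w w' hw => by
        have e := iter_congr (ℋ := ℋ) (η := R) (δ := δ) (α := α) (G := G) (k := k)
          (fun j hj => hw (.inl j) (by simpa using hj))
          (fun j hj => hw (.inr j) (by simpa using hj))
        simp only [Sum.elim_inl, Sum.elim_inr] at e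
        simp only [e]) (i₀ := .inl k) (by simp)
    exact hG.noise hB (hξ k) (hΦ.comp_aemeasurable hsamples) hi (C := 4 * R ^ 2)
      fun ω => inner_sub_le_of_mem_Q hℋ hBm hB htr' hR.le (hsx ω k) hxs
  have hnoise₁ := fun k => by
    have hΦ : Measurable fun w : (ℕ → Ξ) × (ℕ → Ξ) =>
        ((iter ℋ R δ α G w.1 w.2 (k + 1)).xbar,
          (iter ℋ R δ α G w.1 w.2 (k + 1)).x - (iter ℋ R δ α G w.1 w.2 k).x) :=
      (hmeas (k + 1)).2.1.prodMk ((hmeas (k + 1)).1.sub (hmeas k).1)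
    have hi := indepFun_of_finset (fun k => (hξ k).aemeasurable) (fun k => (hξ' k).aemeasurable)
      hind hΦ ((Finset.range (k + 1)).disjSum (Finset.range k)) (fun w w' hw => by
        have h1 : ∀ j < k + 1, w.1 j = w'.1 j := fun j hj => hw (.inl j) (by simpa using hj)
        have h2 : ∀ j < k, w.2 j = w'.2 j := fun j hj => hw (.inr j) (by simpa using hj)
        have e := iter_succ_congr (ℋ := ℋ) (η := R) (δ := δ) (α := α) (G := G) h1 h2
        have e2 := iter_congr (ℋ := ℋ) (η := R) (δ := δ) (α := α) (G := G)
          (fun j (hj : j < k) => h1 j (by omega)) h2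
        simp only [e.1, e.2, e2]) (i₀ := .inr k) (by simp)
    exact hG.noise hB (hξ' k) (hΦ.comp_aemeasurable hsamples) hi (C := 4 * R ^ 2)
      fun ω => inner_sub_le_of_mem_Q hℋ hBm hB htr' hR.le (hsx ω (k + 1)) (hsx ω k)
  have hxbm : AEMeasurable (xbar (K + 1)) P := by
    have h := (hmeas (K + 1)).2.1.comp_aemeasurable hsamples
    exact h.congr (.of_forall fun ω => (hxbar (K + 1) ω).symm)
  have h := integral_le_of_pathwise (P := P) (σ := σ) (a := α) (hα K)
    (F := fun ω => f (xbar (K + 1) ω) - f xs)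
    (N₀ := fun k ω => wnorm (Ring.inverse B) (n₀ ω k) ^ 2)
    (N₁ := fun k ω => wnorm (Ring.inverse B) (n₁ ω k) ^ 2)
    (I₀ := fun k ω => ⟪n₀ ω k, (s ω k).x - xs⟫)
    (I₁ := fun k ω => ⟪n₁ ω k, (s ω (k + 1)).x - (s ω k).x⟫)
    (b := 9 * R * c⁻¹) (e := L * ρ ^ (ν - 1) * ρ ^ 2)
    (c := R * (6 * (δ * Module.finrank ℝ X) + 3 * c))
    ((hconv.locallyLipschitz.continuous.measurable.comp_aemeasurable hxbm).sub_const _)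
    (fun ω => by
      rw [hxbar]
      exact sub_nonneg.2 (hmin (hsxb ω (K + 1))))
    (by positivity) hnoise₀ hnoise₁ (fun ω => by
      rw [hxbar]
      exact pathwise_bound hℋ hBm hB htr hR hδ hL hν hν1 hρ hc hconv hf hxs hmin hG.isSubgradient
        hα0 hα hαs G (fun j => ξ j ω) (fun j => ξ' j ω) (s ω) (fun k => rfl) (y ω) (n₀ ω) (n₁ ω)
        (fun k => rfl) (fun k => rfl) (fun k => rfl) K)
  refine ⟨h.1, h.2.trans (le_of_eq ?_)⟩
  ring

end Expectation

section Rates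

/-! ### Rates -/

theorem sum_sq_weights_le (K : ℕ) :
    ∑ k ∈ Finset.range (K + 1), (1 + (k : ℝ) / 2) ^ 2 ≤ ((K : ℝ) + 1) ^ 3 := by
  calc ∑ k ∈ Finset.range (K + 1), (1 + (k : ℝ) / 2) ^ 2
      ≤ ∑ _k ∈ Finset.range (K + 1), ((K : ℝ) + 1) ^ 2 := by
        refine Finset.sum_le_sum fun k hk => ?_
        have h : (k : ℝ) ≤ K := by exact_mod_cast Nat.lt_succ_iff.1 (Finset.mem_range.1 hk)
        have h0 : (0 : ℝ) ≤ k := Nat.cast_nonneg k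
        exact pow_le_pow_left₀ (by positivity) (by linarith) 2
    _ = ((K : ℝ) + 1) ^ 3 := by simp; ring

/-- With `n = K + 1`, the choice `ρ = R n ^ (-3/2)` balances the inexactness of the smoothness and
`c = 36 R M + σ n ^ (3/2)` balances the noise. -/
theorem rate_of_expectation_bound {R d L ν σ a A E n : ℝ} (hR : 0 < R) (hL : 0 < L)
    (hσ : 0 ≤ σ) (hn : 1 ≤ n) (ha : n / 2 ≤ a) (hA : A ≤ n ^ 3) (hE : 0 ≤ E)
    (hd : 0 ≤ d)
    (h : ∀ ρ c : ℝ, 0 < ρ → 36 * R * (L * ρ ^ (ν - 1)) ≤ c →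
      a ^ 2 * E ≤ R * (6 * d + 3 * c) + (18 * R * c⁻¹ * σ ^ 2 + L * ρ ^ (ν - 1) * ρ ^ 2) * A) :
    E ≤ 436 * (L * R ^ (1 + ν) / n ^ ((3 * ν + 1) / 2) + σ * R / n ^ ((1 : ℝ) / 2)
      + d * R / n ^ 2) := by
  have hn0 : 0 < n := by linarith
  set w := n ^ ((3 : ℝ) / 2) with hw
  have hw0 : 0 < w := Real.rpow_pos_of_pos hn0 _
  have hw2 : w ^ 2 = n ^ 3 := by
    rw [hw, ← Real.rpow_natCast, ← Real.rpow_mul hn0.le, ← Real.rpow_natCast]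
    norm_num
  set ρ := R * w⁻¹ with hρd
  have hρ : 0 < ρ := by positivity
  have hρ2 : ρ ^ 2 = R ^ 2 * (n ^ 3)⁻¹ := by rw [hρd, mul_pow, inv_pow, hw2]
  set M := L * ρ ^ (ν - 1) with hMd
  have hM : 0 < M := mul_pos hL (Real.rpow_pos_of_pos hρ _)
  set c := 36 * R * M + σ * w with hcd
  have hc0 : 0 < c := by positivity
  have h1 := h ρ c hρ (by rw [hcd]; linarith [mul_nonneg hσ hw0.le])
  have h2 : M * ρ ^ 2 * A ≤ M * R ^ 2 := by
    rw [hρ2, mul_assoc]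
    refine mul_le_mul_of_nonneg_left ?_ hM.le
    rw [mul_assoc]
    refine mul_le_of_le_one_right (sq_nonneg R) ?_
    rw [inv_mul_le_iff₀ (by positivity)]
    linarith
  have h3 : 18 * R * c⁻¹ * σ ^ 2 * A ≤ 18 * R * (σ * w) := by
    have h4 : c⁻¹ * (σ ^ 2 * A) ≤ σ * w := by
      rw [inv_mul_le_iff₀ hc0]
      calc σ ^ 2 * A ≤ σ ^ 2 * w ^ 2 := by rw [hw2]; gcongr
        _ = (σ * w) * (σ * w) := by ring
        _ ≤ c * (σ * w) := by
          refine mul_le_mul_of_nonneg_right ?_ (by positivity)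
          rw [hcd]
          linarith [show 0 < 36 * R * M by positivity]
    calc 18 * R * c⁻¹ * σ ^ 2 * A = 18 * R * (c⁻¹ * (σ ^ 2 * A)) := by ring
      _ ≤ _ := by gcongr
  have h5 : n ^ 2 / 4 * E ≤ 109 * (M * R ^ 2) + 21 * (σ * R * w) + 6 * (d * R) := by
    calc n ^ 2 / 4 * E ≤ a ^ 2 * E := by gcongr; nlinarith
      _ ≤ _ := h1
      _ ≤ _ := by rw [add_mul, hcd] at *; linarith
  have e1 : M * R ^ 2 / n ^ 2 = L * R ^ (1 + ν) / n ^ ((3 * ν + 1) / 2) := by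
    have hR1 : R ^ (1 + ν) = R ^ (ν - 1) * R ^ 2 := by
      rw [← Real.rpow_natCast R 2, ← Real.rpow_add hR]
      congr 1
      push_cast
      ring
    have hn1 : (w⁻¹) ^ (ν - 1) / n ^ 2 = 1 / n ^ ((3 * ν + 1) / 2) := by
      rw [hw, ← Real.rpow_neg hn0.le, ← Real.rpow_mul hn0.le, ← Real.rpow_natCast n 2,
        ← Real.rpow_sub hn0, one_div, ← Real.rpow_neg hn0.le]
      congr 1
      push_cast
      ring
    rw [hMd, hρd, Real.mul_rpow hR.le (by positivity), hR1]
    calc L * (R ^ (ν - 1) * w⁻¹ ^ (ν - 1)) * R ^ 2 / n ^ 2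
        = L * (R ^ (ν - 1) * R ^ 2) * (w⁻¹ ^ (ν - 1) / n ^ 2) := by ring
      _ = _ := by rw [hn1]; ring
  have e2 : σ * R * w / n ^ 2 = σ * R / n ^ ((1 : ℝ) / 2) := by
    have : w / n ^ 2 = 1 / n ^ ((1 : ℝ) / 2) := by
      rw [hw, ← Real.rpow_natCast n 2, ← Real.rpow_sub hn0, one_div, ← Real.rpow_neg hn0.le]
      norm_num
    rw [mul_div_assoc, this]
    ring
  rw [← e1, ← e2]
  have h6 : E ≤ (109 * (M * R ^ 2) + 21 * (σ * R * w) + 6 * (d * R)) * 4 / n ^ 2 := by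
    rw [le_div_iff₀ (by positivity)]
    linarith
  calc E ≤ _ := h6
    _ ≤ (109 * (M * R ^ 2) + 109 * (σ * R * w) + 109 * (d * R)) * 4 / n ^ 2 := by
      gcongr <;> norm_num
    _ = _ := by ring

/-- Inversion of a rate `a / n ^ p`, `p ≥ 1/2`. The constant is `(3 * 436) ^ 2`. -/
theorem rate_inversion {a ε p n : ℝ} (ha : 0 ≤ a) (hε : 0 < ε) (hp : 1 / 2 ≤ p) (hn : 0 < n)
    (h : 1710864 * (a / ε) ^ (1 / p) ≤ n) : 436 * (a / n ^ p) ≤ ε / 3 := by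
  have hp0 : 0 < p := by linarith
  have haε : 0 ≤ a / ε := by positivity
  have h1 := Real.rpow_le_rpow (by positivity) h hp0.le
  rw [Real.mul_rpow (by norm_num) (by positivity), ← Real.rpow_mul haε, one_div,
    inv_mul_cancel₀ hp0.ne', Real.rpow_one] at h1
  have h2 : (1308 : ℝ) ≤ 1710864 ^ p := by
    calc (1308 : ℝ) = √(1308 ^ 2) := (Real.sqrt_sq (by norm_num)).symm
      _ = 1710864 ^ ((1 : ℝ) / 2) := by rw [Real.sqrt_eq_rpow]; norm_num
      _ ≤ 1710864 ^ p := Real.rpow_le_rpow_of_exponent_le (by norm_num) hp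
  have h3 : 1308 * (a / ε) ≤ n ^ p := (mul_le_mul_of_nonneg_right h2 haε).trans h1
  have hnp : 0 < n ^ p := Real.rpow_pos_of_pos hn p
  rw [← mul_div_assoc, div_le_iff₀ hε] at h3
  rw [← mul_div_assoc, div_le_iff₀ hnp]
  linarith

end Rates

end Leon

theorem mainTheorem1 :
    ∃ C : ℝ, 0 < C ∧
      ∀ (X : Type*) [NormedAddCommGroup X] [InnerProductSpace ℝ X] [FiniteDimensional ℝ X]
        [MeasurableSpace X] [BorelSpace X]
        (ℋ : Submodule ℝ (X →L[ℝ] X)) (_ : Leon.IsPrecondSpace ℋ)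
        (B : X →L[ℝ] X) (_ : B ∈ ℋ) (_ : Leon.IsPosDef B) (_ : Leon.trNorm B = 1)
        (R δ L ν σ : ℝ) (_ : 0 < R) (_ : 0 < δ) (_ : 0 < L) (_ : 0 ≤ ν) (_ : ν ≤ 1) (_ : 0 ≤ σ)
        (f : X → ℝ) (_ : ConvexOn ℝ Set.univ f) (_ : Leon.IsHolderSmooth f B L ν)
        (xstar : X) (_ : xstar ∈ Leon.Q ℋ R) (_ : IsMinOn f (Leon.Q ℋ R) xstar)
        (Ξ : Type*) [MeasurableSpace Ξ] (D : Measure Ξ) [IsProbabilityMeasure D]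
        (gradf : X → X) (G : Ξ → X → X) (_ : Leon.IsStochGrad f B σ D gradf G)
        (Ω : Type*) [MeasurableSpace Ω] (P : Measure Ω) [IsProbabilityMeasure P]
        (ξ ξ' : ℕ → Ω → Ξ) (_ : ∀ k, HasLaw (ξ k) D P) (_ : ∀ k, HasLaw (ξ' k) D P)
        (_ : iIndepFun (Sum.elim ξ ξ') P)
        (xbar : ℕ → Ω → X)
        (_ : ∀ k ω, xbar k ω =
          (Leon.iter ℋ R δ (fun k => 1 + (k : ℝ) / 2) G
            (fun j => ξ j ω) (fun j => ξ' j ω) k).xbar),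
        (∀ K : ℕ,
          (∀ ω, xbar (K + 1) ω ∈ Leon.Q ℋ R) ∧
          Integrable (fun ω => f (xbar (K + 1) ω) - f xstar) P ∧
          ∫ ω, (f (xbar (K + 1) ω) - f xstar) ∂P ≤
            C * (L * R ^ (1 + ν) / ((K : ℝ) + 1) ^ ((3 * ν + 1) / 2)
              + σ * R / ((K : ℝ) + 1) ^ ((1 : ℝ) / 2)
              + δ * R * (Module.finrank ℝ X : ℝ) / ((K : ℝ) + 1) ^ 2)) ∧
        (∀ ε : ℝ, 0 < ε → ∀ K : ℕ,
          C * ((L * R ^ (1 + ν) / ε) ^ (2 / (1 + 3 * ν)) + (σ * R / ε) ^ 2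
            + (δ * R * (Module.finrank ℝ X : ℝ) / ε) ^ ((1 : ℝ) / 2)) ≤ (K : ℝ) + 1 →
          ∫ ω, (f (xbar (K + 1) ω) - f xstar) ∂P ≤ ε) ∧
        (∀ ε : ℝ, 0 < ε → C * (δ * R * (Module.finrank ℝ X : ℝ)) ≤ ε → ∀ K : ℕ,
          C * ((L * R ^ (1 + ν) / ε) ^ (2 / (1 + 3 * ν)) + (σ * R / ε) ^ 2) ≤ (K : ℝ) + 1 →
          ∫ ω, (f (xbar (K + 1) ω) - f xstar) ∂P ≤ ε) := by
  -- `1710864 = (3 * 436) ^ 2`: each of the three terms of the rate gets a share `ε / 3`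
  refine ⟨1710864, by norm_num, ?_⟩
  intro X _ _ _ _ _ ℋ hℋ B hBm hB htr R δ L ν σ hR hδ hL hν hν1 hσ f hconv hf xs hxs hmin Ξ _ D _
    gradf G hG Ω _ P _ ξ ξ' hξ hξ' hind xbar hxbar
  have hα : ∀ k : ℕ, (1 : ℝ) ≤ 1 + (k : ℝ) / 2 := fun k => by
    have : (0 : ℝ) ≤ k := Nat.cast_nonneg k
    linarith
  have hαs : ∀ k : ℕ, (1 + ((k + 1 : ℕ) : ℝ) / 2) ^ 2 - (1 + ((k + 1 : ℕ) : ℝ) / 2)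
      ≤ (1 + (k : ℝ) / 2) ^ 2 := fun k => by
    push_cast
    nlinarith
  have hQ : ∀ K ω, xbar K ω ∈ Leon.Q ℋ R := fun K ω => by
    rw [hxbar]
    exact Leon.iter_xbar_mem_Q hℋ hR.le hδ hα K
  have hEb := fun K (ρ c : ℝ) (hρ : 0 < ρ) (hc : 36 * R * (L * ρ ^ (ν - 1)) ≤ c) =>
    Leon.expectation_bound hℋ hBm hB htr hR hδ hL hν hν1 hρ hc hconv hf hxs hmin hG hξ hξ' hind
      (α := fun k => 1 + (k : ℝ) / 2) (by norm_num) hα hαs hxbar K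
  have hn : ∀ K : ℕ, (1 : ℝ) ≤ (K : ℝ) + 1 := fun K => by
    have : (0 : ℝ) ≤ K := Nat.cast_nonneg K
    linarith
  have hrate : ∀ K : ℕ, ∫ ω, (f (xbar (K + 1) ω) - f xs) ∂P ≤
      436 * (L * R ^ (1 + ν) / ((K : ℝ) + 1) ^ ((3 * ν + 1) / 2)
        + σ * R / ((K : ℝ) + 1) ^ ((1 : ℝ) / 2)
        + δ * R * (Module.finrank ℝ X : ℝ) / ((K : ℝ) + 1) ^ 2) := fun K => by
    have h := Leon.rate_of_expectation_bound (d := δ * (Module.finrank ℝ X : ℝ)) (ν := ν)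
      (a := 1 + (K : ℝ) / 2) hR hL hσ (hn K) (by linarith)
      (Leon.sum_sq_weights_le K)
      (integral_nonneg fun ω => sub_nonneg.2 (hmin (hQ (K + 1) ω))) (by positivity)
      fun ρ c hρ hc => (hEb K ρ c hρ hc).2
    rwa [mul_right_comm δ] at h
  have hd : 0 ≤ δ * R * (Module.finrank ℝ X : ℝ) := by positivity
  have hLR : 0 ≤ L * R ^ (1 + ν) := by positivity
  have hσR : 0 ≤ σ * R := by positivity
  -- the first two terms of the rate, once `K + 1` exceeds the corresponding complexities
  have hterm₁ : ∀ ε : ℝ, 0 < ε → ∀ K : ℕ,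
      1710864 * (L * R ^ (1 + ν) / ε) ^ (2 / (1 + 3 * ν)) ≤ (K : ℝ) + 1 →
      436 * (L * R ^ (1 + ν) / ((K : ℝ) + 1) ^ ((3 * ν + 1) / 2)) ≤ ε / 3 := fun ε hε K hK => by
    refine Leon.rate_inversion hLR hε (by linarith) (by linarith [hn K]) ?_
    rwa [one_div_div, add_comm (3 * ν)]
  have hterm₂ : ∀ ε : ℝ, 0 < ε → ∀ K : ℕ, 1710864 * (σ * R / ε) ^ 2 ≤ (K : ℝ) + 1 →
      436 * (σ * R / ((K : ℝ) + 1) ^ ((1 : ℝ) / 2)) ≤ ε / 3 := fun ε hε K hK => by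
    refine Leon.rate_inversion hσR hε le_rfl (by linarith [hn K]) ?_
    rwa [one_div_one_div, Real.rpow_two]
  refine ⟨fun K => ⟨hQ (K + 1), (hEb K 1 _ one_pos le_rfl).1, (hrate K).trans ?_⟩,
    fun ε hε K hK => (hrate K).trans ?_, fun ε hε hδε K hK => (hrate K).trans ?_⟩
  · have hK0 : (0 : ℝ) < (K : ℝ) + 1 := by linarith [hn K]
    gcongr
    norm_num
  · have p1 : 0 ≤ (L * R ^ (1 + ν) / ε) ^ (2 / (1 + 3 * ν)) := by positivity
    have p2 : 0 ≤ (σ * R / ε) ^ 2 := by positivity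
    have p3 : 0 ≤ (δ * R * (Module.finrank ℝ X : ℝ) / ε) ^ ((1 : ℝ) / 2) := by positivity
    have h1 := hterm₁ ε hε K (by linarith)
    have h2 := hterm₂ ε hε K (by linarith)
    have h3 := Leon.rate_inversion (p := 2) hd hε (by norm_num)
      (show (0 : ℝ) < (K : ℝ) + 1 by linarith [hn K]) (by linarith)
    rw [Real.rpow_two] at h3
    linarith
  · have p1 : 0 ≤ (L * R ^ (1 + ν) / ε) ^ (2 / (1 + 3 * ν)) := by positivity
    have p2 : 0 ≤ (σ * R / ε) ^ 2 := by positivity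
    have h1 := hterm₁ ε hε K (by linarith)
    have h2 := hterm₂ ε hε K (by linarith)
    have h3 : δ * R * (Module.finrank ℝ X : ℝ) / ((K : ℝ) + 1) ^ 2
        ≤ δ * R * (Module.finrank ℝ X : ℝ) := div_le_self hd (one_le_pow₀ (hn K))
    linarith
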